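/- Let $R$ be a commutative Noetherian ring and let $\Gamma$ be a Noetherian $R$-algebra, i.e. an $R$-algebra that is finitely generated as an $R$-module. Let $M$ be a finitely generated $\Gamma$-bimodule on which $R$ acts centrally ($rx=xr$ for all $r\in R$, $x\in M$), and let $n\ge 1$ be an integer with $M^{\otimes_\Gamma n}=0$. Let $T_\Gamma(M)=\Gamma\oplus M\oplus (M\otimes_\Gamma M)\oplus\cdots$ be the tensor ring. Then $\Gamma$ and $T_\Gamma(M)$ are right Noetherian, so that the categories $\mathrm{mod}\,\Gamma$ and $\mathrm{mod}\,T_\Gamma(M)$ of finitely generated right modules are abelian with enough projectives, and the following hold (in $\mathbb N\cup\{\infty\}$). (1) If ${}_\Gamma M$ and $M_\Gamma$ are projective, then $$\mathrm{IT}(\Gamma)\le \mathrm{IT}(T_\Gamma(M))\le n(\mathrm{IT}(\Gamma)+1)-1$$ and $$\dim(\Gamma)\le\dim(T_\Gamma(M))\le n(\dim(\Gamma)+1)-1 .$$ (2) If $M$ is left perfect, i.e. $M$ has finite projective dimension as a left $\Gamma$-module and $\mathrm{Tor}_i^\Gamma(M,M^{\otimes j})=0$ for all $i,j\ge 1$,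 then $$\mathrm{der.dim}\,D^b(\mathrm{mod}\,\Gamma)\le \mathrm{der.dim}\,D^b(\mathrm{mod}\,T_\Gamma(M))\le n(\mathrm{der.dim}\,D^b(\mathrm{mod}\,\Gamma)+1)-1 .$$ Here, for an object or class of objects $U$ of an additive category, $\mathrm{add}(U)$ consists of the direct summands of finite direct sums of objects of $U$, and: - $\mathrm{IT}(\Lambda)$, the Igusa–Todorov distance of $\mathscr A=\mathrm{mod}\,\Lambda$, is the infimum of the $m\ge 0$ for which there are $t\ge 0$ and $U\in\mathscr A$ such that every $A\in\mathscr A$ admits an exact sequence $0\to U_m\to\cdots\to U_0\to\Omega^t(A)\to 0$ with all $U_i\in\mathrm{add}(U)$, where $\Omega^t(A)$ is a $t$-th syzygy of $A$. - $\dim(\Lambda)$, the extension dimension of $\mathscr A=\mathrm{mod}\,\Lambda$, is the infimum of the $m\ge 0$ with $\mathscr A=[T]_{m+1}$ for some $T\in\mathscr A$, where $[T]_1=\mathrm{add}(T)$ and $[T]_{k}=\mathrm{add}$ of the class of all $A$ with an exact sequence $0\to X\to A\to Y\to 0$, $X\in[T]_1$, $Y\in[T]_{k-1}$, for $k\ge2$.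 - $\mathrm{der.dim}\,\mathscr T$, the Rouquier dimension of a triangulated category $\mathscr T$, is the infimum of the $m\ge 0$ with $\mathscr T=\langle G\rangle_{m+1}$ for some $G\in\mathscr T$, where $\langle\mathcal U\rangle_1$ is the smallest full subcategory containing $\mathcal U$ and closed under finite direct sums, direct summands and shifts, and $\langle G\rangle_{k+1}=\langle \mathcal C\rangle_1$ with $\mathcal C$ the class of all $A$ in a triangle $X\to A\to Y\to X[1]$, $X\in\langle G\rangle_1$, $Y\in\langle G\rangle_k$. -/

import Mathlib

open CategoryTheory CategoryTheory.Limits CategoryTheory.Pretriangulated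
open scoped TensorProduct MulOpposite ZeroObject

/-! ## Igusa-Todorov distance and extension dimension of an abelian category -/

section AbelianCategory

universe v u

attribute [local instance] Abelian.hasFiniteBiproducts

variable {C : Type u} [Category.{v} C] [Abelian C]

/-- `add P`: the direct summands of finite direct sums of objects satisfying `P`. -/
def addClosure (P : ObjectProperty C) : ObjectProperty C := fun X =>
  ∃ (k : ℕ) (f : Fin k → C), (∀ i, P (f i)) ∧ Nonempty (Retract X (⨁ f))

/-- `K` is an `n`-th syzygy of `A`: a zeroth syzygy of `A` is (a copy of) `A` itself, and an
`(n+1)`-st syzygy is the kernel of an epimorphism from a projective object onto an `n`-th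
syzygy. -/
def IsSyzygy : ℕ → C → C → Prop
  | 0, A, K => Nonempty (K ≅ A)
  | n + 1, A, K => ∃ (L P : C) (i : K ⟶ P) (p : P ⟶ L) (w : i ≫ p = 0),
      IsSyzygy n A L ∧ Projective P ∧ (ShortComplex.mk i p w).ShortExact

/-- There is an exact sequence `0 ⟶ U_m ⟶ ⋯ ⟶ U_1 ⟶ U_0 ⟶ A ⟶ 0` with all `U_i` in `add U`,
presented as a splice of short exact sequences `0 ⟶ K ⟶ U_0 ⟶ A ⟶ 0`,
`0 ⟶ K' ⟶ U_1 ⟶ K ⟶ 0`, and so on. -/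
def HasAddResolution (U : C) : ℕ → C → Prop
  | 0, A => addClosure (fun X => X = U) A
  | m + 1, A => ∃ (K U₀ : C) (i : K ⟶ U₀) (p : U₀ ⟶ A) (w : i ≫ p = 0),
      addClosure (fun X => X = U) U₀ ∧ (ShortComplex.mk i p w).ShortExact ∧
        HasAddResolution U m K

variable (C) in
/-- `C` is an `(m, n)`-Igusa-Todorov category. By Schanuel's lemma, after enlarging `U` by the
projectives involved, it does not matter which `n`-th syzygy of `A` is taken. -/
def IsIgusaTodorov (m n : ℕ) : Prop :=
  ∃ U : C, ∀ A : C, ∃ K : C, IsSyzygy n A K ∧ HasAddResolution U m K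

variable (C) in
/-- The Igusa-Todorov distance of `C` (it is `⊤` if `C` is `(m, n)`-Igusa-Todorov for no
`m`, `n`). -/
noncomputable def igusaTodorovDistance : ℕ∞ :=
  ⨅ (m : ℕ) (_ : ∃ n : ℕ, IsIgusaTodorov C m n), (m : ℕ∞)

/-- `P • Q`: the direct summands of finite direct sums of extensions `0 ⟶ X ⟶ A ⟶ Y ⟶ 0` with
`X` in `P` and `Y` in `Q`. -/
def extensionProduct (P Q : ObjectProperty C) : ObjectProperty C :=
  addClosure fun A => ∃ (X Y : C) (i : X ⟶ A) (p : A ⟶ Y) (w : i ≫ p = 0),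
    P X ∧ Q Y ∧ (ShortComplex.mk i p w).ShortExact

/-- `[P]_n`: `[P]_0 = 0`, `[P]_1 = add P`, and `[P]_n = [P]_1 • [P]_{n-1}` for `n ≥ 2`. -/
def extensionPower (P : ObjectProperty C) : ℕ → ObjectProperty C
  | 0 => fun X => IsZero X
  | 1 => addClosure P
  | n + 2 => extensionProduct (addClosure P) (extensionPower P (n + 1))

variable (C) in
/-- The extension dimension of `C` (it is `⊤` if no `[T]_{n+1}` is the whole of `C`). -/
noncomputable def extensionDimension : ℕ∞ :=
  ⨅ (n : ℕ) (_ : ∃ T : C, ∀ A : C, extensionPower (fun X => X = T) (n + 1) A), (n : ℕ∞)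

end AbelianCategory

/-! ## Rouquier dimension of a triangulated category -/

section TriangulatedCategory

universe v u

variable {T : Type u} [Category.{v} T] [HasZeroObject T] [HasShift T ℤ] [Preadditive T]
  [∀ n : ℤ, (shiftFunctor T n).Additive] [Pretriangulated T]

/-- `⟨P⟩_1`: the smallest full subcategory which contains `P` and is closed under finite direct
sums, direct summands (in particular, isomorphisms) and shifts. -/
inductive thickOne (P : ObjectProperty T) : T → Prop
  | of (X : T) (hX : P X) : thickOne P X
  | zero (X : T) (hX : IsZero X) : thickOne P X
  | directSum (X Y S : T) (inl : X ⟶ S) (fst : S ⟶ X) (inr : Y ⟶ S) (snd : S ⟶ Y)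
      (h₁ : inl ≫ fst = 𝟙 X) (h₂ : inr ≫ snd = 𝟙 Y) (h : fst ≫ inl + snd ≫ inr = 𝟙 S)
      (hX : thickOne P X) (hY : thickOne P Y) : thickOne P S
  | summand (X Y : T) (r : Retract X Y) (hY : thickOne P Y) : thickOne P X
  | shift (X : T) (n : ℤ) (hX : thickOne P X) : thickOne P (X⟦n⟧)

/-- `P * Q`: the objects `A` in a distinguished triangle `X ⟶ A ⟶ Y ⟶ X⟦1⟧` with `X` in `P` and
`Y` in `Q`. -/
def triangleProduct (P Q : ObjectProperty T) : ObjectProperty T := fun A =>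
  ∃ (X Y : T) (f : X ⟶ A) (g : A ⟶ Y) (h : Y ⟶ X⟦(1 : ℤ)⟧),
    P X ∧ Q Y ∧ Triangle.mk f g h ∈ distTriang T

/-- `⟨P⟩_n`: `⟨P⟩_0 = 0` and `⟨P⟩_{n+1} = ⟨P⟩_1 ⋄ ⟨P⟩_n = ⟨⟨P⟩_1 * ⟨P⟩_n⟩_1`. -/
def thickPower (P : ObjectProperty T) : ℕ → ObjectProperty T
  | 0 => fun X => IsZero X
  | n + 1 => thickOne (triangleProduct (thickOne P) (thickPower P n))

variable (T) in
/-- The dimension of a triangulated category (it is `⊤` if no `⟨G⟩_{n+1}` is the whole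
category). -/
noncomputable def rouquierDimension : ℕ∞ :=
  ⨅ (n : ℕ) (_ : ∃ G : T, ∀ A : T, thickPower (fun X => X = G) (n + 1) A), (n : ℕ∞)

end TriangulatedCategory

/-! ## The invariants of a right Noetherian ring

Right `A`-modules are left modules over the opposite ring, so `FGModuleCat Aᵐᵒᵖ` is the category
`mod A` of finitely generated right `A`-modules. -/

section RingInvariants

universe u

variable (A : Type u) [Ring A] [IsNoetherianRing Aᵐᵒᵖ]

/-- `IT(A)`, the Igusa-Todorov distance of `mod A`. -/
noncomputable def ringIT : ℕ∞ := igusaTodorovDistance (FGModuleCat.{u} Aᵐᵒᵖ)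

/-- `dim A`, the extension dimension of `mod A`. -/
noncomputable def ringExtDim : ℕ∞ := extensionDimension (FGModuleCat.{u} Aᵐᵒᵖ)

/-- The Rouquier dimension of the bounded derived category of `mod A`. -/
noncomputable def ringDerDim : ℕ∞ :=
  letI := HasDerivedCategory.standard (FGModuleCat.{u} Aᵐᵒᵖ)
  rouquierDimension (DerivedCategory.Bounded (FGModuleCat.{u} Aᵐᵒᵖ))

end RingInvariants

/-! ## Tensor products over a noncommutative ring -/

section BalancedTensor

universe u

variable (A : Type u) [Ring A]

section

variable (X Y : Type u) [AddCommGroup X] [AddCommGroup Y] [Module Aᵐᵒᵖ X] [Module A Y]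

/-- The relations `(x a) ⊗ y = x ⊗ (a y)`. -/
def balancedRelations : AddSubgroup (X ⊗[ℤ] Y) :=
  AddSubgroup.closure {t | ∃ (x : X) (a : A) (y : Y),
    t = (MulOpposite.op a • x) ⊗ₜ[ℤ] y - x ⊗ₜ[ℤ] (a • y)}

/-- The tensor product `X ⊗_A Y` of a right `A`-module and a left `A`-module. -/
def BalancedTensor : Type u := (X ⊗[ℤ] Y) ⧸ balancedRelations A X Y

noncomputable instance : AddCommGroup (BalancedTensor A X Y) :=
  inferInstanceAs (AddCommGroup ((X ⊗[ℤ] Y) ⧸ balancedRelations A X Y))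

end

namespace BalancedTensor

variable {X Y X' Y' X'' Y'' : Type u}
  [AddCommGroup X] [AddCommGroup Y] [Module Aᵐᵒᵖ X] [Module A Y]
  [AddCommGroup X'] [AddCommGroup Y'] [Module Aᵐᵒᵖ X'] [Module A Y']
  [AddCommGroup X''] [AddCommGroup Y''] [Module Aᵐᵒᵖ X''] [Module A Y'']

/-- The elementary tensor `x ⊗ y`. -/
noncomputable def tmul (x : X) (y : Y) : BalancedTensor A X Y :=
  QuotientAddGroup.mk' (balancedRelations A X Y) (x ⊗ₜ[ℤ] y)

variable {A}

theorem induction_on {p : BalancedTensor A X Y → Prop} (t : BalancedTensor A X Y)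
    (zero : p 0) (tmul : ∀ x y, p (tmul A x y)) (add : ∀ s t, p s → p t → p (s + t)) : p t := by
  obtain ⟨t, rfl⟩ := QuotientAddGroup.mk'_surjective _ t
  induction t using TensorProduct.induction_on with
  | zero => exact zero
  | tmul x y => exact tmul x y
  | add s t hs ht => exact add _ _ hs ht

theorem hom_ext {Z : Type u} [AddCommGroup Z] {f g : BalancedTensor A X Y →+ Z}
    (h : ∀ x y, f (tmul A x y) = g (tmul A x y)) : f = g := by
  ext t
  induction t using induction_on with
  | zero => simp
  | tmul x y => exact h x y
  | add s t hs ht => simp [hs, ht]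

/-- The map `f ⊗ g`. -/
noncomputable def map (f : X →ₗ[Aᵐᵒᵖ] X') (g : Y →ₗ[A] Y') :
    BalancedTensor A X Y →+ BalancedTensor A X' Y' :=
  QuotientAddGroup.map (balancedRelations A X Y) (balancedRelations A X' Y')
    (TensorProduct.map f.toAddMonoidHom.toIntLinearMap
      g.toAddMonoidHom.toIntLinearMap).toAddMonoidHom (by
        refine (AddSubgroup.closure_le _).2 ?_
        rintro _ ⟨x, a, y, rfl⟩
        refine AddSubgroup.subset_closure ⟨f x, a, g y, ?_⟩
        simp)

@[simp] theorem map_tmul (f : X →ₗ[Aᵐᵒᵖ] X') (g : Y →ₗ[A] Y') (x : X) (y : Y) :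
    map f g (tmul A x y) = tmul A (f x) (g y) := rfl

theorem add_tmul (x x' : X) (y : Y) : tmul A (x + x') y = tmul A x y + tmul A x' y :=
  congrArg (QuotientAddGroup.mk' (balancedRelations A X Y)) (TensorProduct.add_tmul x x' y)

theorem tmul_add (x : X) (y y' : Y) : tmul A x (y + y') = tmul A x y + tmul A x y' :=
  congrArg (QuotientAddGroup.mk' (balancedRelations A X Y)) (TensorProduct.tmul_add x y y')

theorem zero_tmul (y : Y) : tmul A (0 : X) y = 0 :=
  congrArg (QuotientAddGroup.mk' (balancedRelations A X Y)) (TensorProduct.zero_tmul X y)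

theorem tmul_zero (x : X) : tmul A x (0 : Y) = 0 :=
  congrArg (QuotientAddGroup.mk' (balancedRelations A X Y)) (TensorProduct.tmul_zero Y x)

/-- The left action `a (x ⊗ y) = (a x) ⊗ y`, for a bimodule `X`. -/
noncomputable instance leftModule [Module A X] [SMulCommClass A Aᵐᵒᵖ X] :
    Module A (BalancedTensor A X Y) where
  smul a t := map (DistribSMul.toLinearMap Aᵐᵒᵖ X a) LinearMap.id t
  one_smul t := DFunLike.congr_fun (f := map (DistribSMul.toLinearMap Aᵐᵒᵖ X (1 : A))
    (LinearMap.id (R := A) (M := Y))) (g := AddMonoidHom.id _) (hom_ext (by simp)) t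
  mul_smul a b t := DFunLike.congr_fun (f := map (DistribSMul.toLinearMap Aᵐᵒᵖ X (a * b))
    (LinearMap.id (R := A) (M := Y)))
    (g := (map (DistribSMul.toLinearMap Aᵐᵒᵖ X a) LinearMap.id).comp
      (map (DistribSMul.toLinearMap Aᵐᵒᵖ X b) LinearMap.id))
    (hom_ext (by simp [mul_smul])) t
  smul_zero a := map_zero _
  smul_add a := map_add _
  add_smul a b t := DFunLike.congr_fun (f := map (DistribSMul.toLinearMap Aᵐᵒᵖ X (a + b))
    (LinearMap.id (R := A) (M := Y)))
    (g := map (DistribSMul.toLinearMap Aᵐᵒᵖ X a) LinearMap.id +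
      map (DistribSMul.toLinearMap Aᵐᵒᵖ X b) LinearMap.id)
    (hom_ext (by simp [add_smul, add_tmul])) t
  zero_smul t := DFunLike.congr_fun (f := map (DistribSMul.toLinearMap Aᵐᵒᵖ X (0 : A))
    (LinearMap.id (R := A) (M := Y))) (g := 0) (hom_ext (by simp [zero_tmul])) t

/-- The right action `(x ⊗ y) a = x ⊗ (y a)`, for a bimodule `Y`. -/
noncomputable instance rightModule [Module Aᵐᵒᵖ Y] [SMulCommClass A Aᵐᵒᵖ Y] :
    Module Aᵐᵒᵖ (BalancedTensor A X Y) :=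
  haveI : SMulCommClass Aᵐᵒᵖ A Y := SMulCommClass.symm _ _ _
  { smul a t := map LinearMap.id (DistribSMul.toLinearMap A Y a) t
    one_smul t := DFunLike.congr_fun (f := map (LinearMap.id (R := Aᵐᵒᵖ) (M := X))
      (DistribSMul.toLinearMap A Y (1 : Aᵐᵒᵖ))) (g := AddMonoidHom.id _) (hom_ext (by simp)) t
    mul_smul a b t := DFunLike.congr_fun (f := map (LinearMap.id (R := Aᵐᵒᵖ) (M := X))
      (DistribSMul.toLinearMap A Y (a * b)))
      (g := (map LinearMap.id (DistribSMul.toLinearMap A Y a)).comp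
        (map LinearMap.id (DistribSMul.toLinearMap A Y b)))
      (hom_ext (by simp [mul_smul])) t
    smul_zero a := map_zero _
    smul_add a := map_add _
    add_smul a b t := DFunLike.congr_fun (f := map (LinearMap.id (R := Aᵐᵒᵖ) (M := X))
      (DistribSMul.toLinearMap A Y (a + b)))
      (g := map LinearMap.id (DistribSMul.toLinearMap A Y a) +
        map LinearMap.id (DistribSMul.toLinearMap A Y b))
      (hom_ext (by simp [add_smul, tmul_add])) t
    zero_smul t := DFunLike.congr_fun (f := map (LinearMap.id (R := Aᵐᵒᵖ) (M := X))
      (DistribSMul.toLinearMap A Y (0 : Aᵐᵒᵖ))) (g := 0) (hom_ext (by simp [tmul_zero])) t }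

@[simp] theorem smul_tmul [Module A X] [SMulCommClass A Aᵐᵒᵖ X] (a : A) (x : X) (y : Y) :
    a • tmul A x y = tmul A (a • x) y := rfl

@[simp] theorem op_smul_tmul [Module Aᵐᵒᵖ Y] [SMulCommClass A Aᵐᵒᵖ Y] (a : Aᵐᵒᵖ) (x : X) (y : Y) :
    a • tmul A x y = tmul A x (a • y) := rfl

instance [Module A X] [SMulCommClass A Aᵐᵒᵖ X] [Module Aᵐᵒᵖ Y] [SMulCommClass A Aᵐᵒᵖ Y] :
    SMulCommClass A Aᵐᵒᵖ (BalancedTensor A X Y) where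
  smul_comm a b t := by
    induction t using induction_on with
    | zero => simp only [smul_zero]
    | tmul x y => rfl
    | add s t hs ht => simp only [smul_add, hs, ht]

end BalancedTensor

/-- The functor `X ⊗_A -` from left `A`-modules to abelian groups, for a right `A`-module `X`. -/
noncomputable def balancedTensorFunctor (X : Type u) [AddCommGroup X] [Module Aᵐᵒᵖ X] :
    ModuleCat.{u} A ⥤ AddCommGrpCat.{u} where
  obj Y := AddCommGrpCat.of (BalancedTensor A X Y)
  map f := AddCommGrpCat.ofHom (BalancedTensor.map LinearMap.id f.hom)
  map_id Y := by
    refine AddCommGrpCat.hom_ext (BalancedTensor.hom_ext fun x y => rfl)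
  map_comp f g := by
    refine AddCommGrpCat.hom_ext (BalancedTensor.hom_ext fun x y => rfl)

instance (X : Type u) [AddCommGroup X] [Module Aᵐᵒᵖ X] :
    (balancedTensorFunctor A X).Additive where
  map_add {_ _ f g} := AddCommGrpCat.hom_ext (BalancedTensor.hom_ext fun x y =>
    BalancedTensor.tmul_add x (f.hom y) (g.hom y))

/-- `Tor_i^A(X, Y)` for a right `A`-module `X` and a left `A`-module `Y`: the `i`-th left derived
functor of `X ⊗_A -`, evaluated at `Y`. -/
noncomputable def balancedTor (i : ℕ) (X Y : Type u) [AddCommGroup X] [Module Aᵐᵒᵖ X]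
    [AddCommGroup Y] [Module A Y] : AddCommGrpCat.{u} :=
  ((balancedTensorFunctor A X).leftDerived i).obj (ModuleCat.of A Y)

/-- An `A`-bimodule. -/
structure RingBimodule where
  carrier : Type u
  [addCommGroup : AddCommGroup carrier]
  [left : Module A carrier]
  [right : Module Aᵐᵒᵖ carrier]
  [comm : SMulCommClass A Aᵐᵒᵖ carrier]

attribute [instance] RingBimodule.addCommGroup RingBimodule.left RingBimodule.right
  RingBimodule.comm

end BalancedTensor

/-! ## Tensor powers of a bimodule, left perfect bimodules and the tensor ring -/

section TensorRing

universe u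

variable (A M : Type u) [Ring A] [AddCommGroup M] [Module A M] [Module Aᵐᵒᵖ M]
  [SMulCommClass A Aᵐᵒᵖ M]

/-- The tensor power `M ⊗_A ⋯ ⊗_A M`, as an `A`-bimodule: it is `A` for `n = 0`, and the
`(n+1)`-st power is the `n`-th power tensored with `M`. -/
noncomputable def bimodulePowerAux : ℕ → RingBimodule.{u} A
  | 0 => ⟨A⟩
  | n + 1 => ⟨BalancedTensor A (bimodulePowerAux n).carrier M⟩

/-- The tensor power `M ⊗_A ⋯ ⊗_A M` (`n` factors). -/
abbrev BimodulePower (n : ℕ) : Type u := (bimodulePowerAux A M n).carrier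

/-- The bimodule `M` is left perfect: it has finite projective dimension as a left `A`-module, and
`Tor_i^A(M, M^{⊗j}) = 0` for all `i, j ≥ 1`. -/
def IsLeftPerfect : Prop :=
  (∃ d : ℕ, HasProjectiveDimensionLE (ModuleCat.of A M) d) ∧
    ∀ i j : ℕ, 1 ≤ i → 1 ≤ j → IsZero (balancedTor A i M (BimodulePower A M j))

/-- The defining relations of the tensor ring: the generators coming from `A` form a copy of the
ring `A`, and the generators coming from `M` depend on `M` additively and in a way compatible with
the two actions of `A`. -/
inductive TensorRingRel : FreeAlgebra ℤ (A ⊕ M) → FreeAlgebra ℤ (A ⊕ M) → Prop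
  | one : TensorRingRel (FreeAlgebra.ι ℤ (Sum.inl 1)) 1
  | add (a b : A) : TensorRingRel (FreeAlgebra.ι ℤ (Sum.inl (a + b)))
      (FreeAlgebra.ι ℤ (Sum.inl a) + FreeAlgebra.ι ℤ (Sum.inl b))
  | mul (a b : A) : TensorRingRel (FreeAlgebra.ι ℤ (Sum.inl (a * b)))
      (FreeAlgebra.ι ℤ (Sum.inl a) * FreeAlgebra.ι ℤ (Sum.inl b))
  | add_right (x y : M) : TensorRingRel (FreeAlgebra.ι ℤ (Sum.inr (x + y)))
      (FreeAlgebra.ι ℤ (Sum.inr x) + FreeAlgebra.ι ℤ (Sum.inr y))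
  | left_smul (a : A) (x : M) : TensorRingRel (FreeAlgebra.ι ℤ (Sum.inr (a • x)))
      (FreeAlgebra.ι ℤ (Sum.inl a) * FreeAlgebra.ι ℤ (Sum.inr x))
  | right_smul (a : A) (x : M) :
      TensorRingRel (FreeAlgebra.ι ℤ (Sum.inr (MulOpposite.op a • x)))
        (FreeAlgebra.ι ℤ (Sum.inr x) * FreeAlgebra.ι ℤ (Sum.inl a))

/-- The tensor ring `T_A(M) = A ⊕ M ⊕ (M ⊗_A M) ⊕ ⋯`, as the ring generated by the ring `A` and
the `A`-bimodule `M`. -/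
def TensorRing : Type u := RingQuot (TensorRingRel A M)

noncomputable instance : Ring (TensorRing A M) :=
  inferInstanceAs (Ring (RingQuot (TensorRingRel A M)))

end TensorRing

universe u w

/-!
Let `T` be the tensor ring, `ι : Γ → T` and `ε : T → Γ` its structure maps, so that `ε ∘ ι = id`,
and let `I = ker ε`. Restriction along `ε` followed by restriction along `ι` is the identity of
`mod Γ`, so restriction along `ι` is an exact and essentially surjective functor
`mod T → mod Γ`; none of the three invariants increases along such a functor, which gives the lower
bounds (for the Igusa–Todorov distance it must also preserve projectives, and it does because `T`
is a retract of the sum of the tensor powers of `M`).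

For the upper bounds, `X / X I` is restricted from `Γ` along `ε` for every `T`-module `X`, naturally
in `X`. Since `I ^ n = 0`, every `T`-module, and every bounded complex of `T`-modules, is filtered
with `n` layers coming from `Γ`, and `n` layers with `m + 1` steps each make `n * (m + 1)` steps.
For the Igusa–Todorov distance one also has to compare syzygies. By the Fox derivative
`T → M ⊗_Γ T`, the multiplication map `M ⊗_Γ T → I` is surjective and split, so `I` is a projective
right `T`-module if `M` is projective over `Γ` on the right. Hence projective `Γ`-modules have
projective dimension at most one over `T`, and one further syzygy makes up for the difference.
-/

section AddClosed

universe v u' v'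

/-- A property of objects is *additively closed* if it is stable under direct summands and finite
direct sums. -/
class IsAddClosed {C : Type u} [Category.{v} C] [Preadditive C] [HasFiniteBiproducts C]
    (P : ObjectProperty C) : Prop extends P.IsStableUnderRetracts where
  biproduct {k : ℕ} (f : Fin k → C) (hf : ∀ i, P (f i)) : P (⨁ f)

namespace IsAddClosed

variable {C : Type u} [Category.{v} C] [Preadditive C] [HasFiniteBiproducts C]
  {D : Type u'} [Category.{v'} D] [Preadditive D] [HasFiniteBiproducts D] {P : ObjectProperty C}

theorem of_isZero_of_biprod [HasBinaryBiproducts C] [P.IsStableUnderRetracts]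
    (hzero : ∀ ⦃X⦄, IsZero X → P X) (hbiprod : ∀ ⦃X Y⦄, P X → P Y → P (X ⊞ Y)) : IsAddClosed P where
  biproduct {k} f hf := by
    induction k with
    | zero => exact hzero ((IsZero.iff_id_eq_zero _).2 (by ext i; exact i.elim0))
    | succ k ih =>
      refine P.prop_of_retract ⟨biprod.lift (biproduct.π f 0)
        (biproduct.lift fun i : Fin k => biproduct.π f i.succ),
        biprod.desc (biproduct.ι f 0) (biproduct.desc fun i => biproduct.ι f i.succ), ?_⟩
        (hbiprod (hf 0) (ih (fun i => f i.succ) fun i => hf i.succ))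
      rw [biprod.lift_desc, biproduct.lift_desc, ← biproduct.total, Fin.sum_univ_succ]

instance isProjective [HasBinaryBiproducts C] : IsAddClosed (CategoryTheory.isProjective C) :=
  have : (CategoryTheory.isProjective C).IsStableUnderRetracts :=
    ⟨fun r (_ : Projective _) => r.projective⟩
  of_isZero_of_biprod (fun _ h => ⟨fun _ _ _ => ⟨0, h.eq_of_src _ _⟩⟩)
    fun _ _ (_ : Projective _) (_ : Projective _) => inferInstanceAs (Projective (_ ⊞ _))

variable [IsAddClosed P]

theorem biproduct_of_finite {ι : Type} [Finite ι] (f : ι → C) (hf : ∀ i, P (f i)) :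
    P (⨁ f) := by
  obtain ⟨k, ⟨e⟩⟩ := Finite.exists_equiv_fin ι
  exact P.prop_of_iso (biproduct.reindex e.symm f) (biproduct (f ∘ e.symm) fun i => hf _)

instance : P.ContainsZero where
  exists_zero := ⟨_, (IsZero.iff_id_eq_zero _).2 (by ext i; exact i.elim0),
    biproduct (fun i : Fin 0 => i.elim0) fun i => i.elim0⟩

theorem biprod [HasBinaryBiproducts C] {X Y : C} (hX : P X) (hY : P Y) : P (X ⊞ Y) := by
  let f : Bool → C := fun b => cond b X Y
  refine P.prop_of_retract
    ⟨biprod.desc (biproduct.ι f true) (biproduct.ι f false),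
      biprod.lift (biproduct.π f true) (biproduct.π f false), ?_⟩
    (biproduct_of_finite f (Bool.rec hY hX))
  ext <;> simp [f]

instance inverseImage (F : D ⥤ C) [F.Additive] : IsAddClosed (P.inverseImage F) where
  of_retract r h := P.prop_of_retract (r.map F) h
  biproduct f hf := P.prop_of_iso (F.mapBiproduct f).symm (biproduct (F.obj ∘ f) hf)

end IsAddClosed

end AddClosed

section AddClosure

universe v

attribute [local instance] Abelian.hasFiniteBiproducts

variable {C : Type u} [Category.{v} C] [Abelian C]

theorem le_addClosure (P : ObjectProperty C) : P ≤ addClosure P := fun X hX =>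
  ⟨1, fun _ => X, fun _ => hX, ⟨biproduct.ι (fun _ : Fin 1 => X) 0,
    biproduct.π (fun _ : Fin 1 => X) 0, by simp⟩⟩

instance (P : ObjectProperty C) : IsAddClosed (addClosure P) where
  of_retract := fun r ⟨k, f, hf, ⟨s⟩⟩ => ⟨k, f, hf, ⟨r.trans s⟩⟩
  biproduct {k} f hf := by
    choose l g hg r using hf
    let s : Retract (⨁ f) (⨁ fun i => ⨁ g i) :=
      ⟨biproduct.map fun i => (r i).some.i, biproduct.map fun i => (r i).some.r, by ext; simp⟩
    obtain ⟨N, ⟨e⟩⟩ := Finite.exists_equiv_fin (Σ i, Fin (l i))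
    let e' := biproductBiproductIso _ g ≪≫ (biproduct.reindex e.symm fun p => g p.1 p.2).symm
    exact ⟨N, fun j => g (e.symm j).1 (e.symm j).2, fun j => hg _ _,
      ⟨s.trans (Retract.ofIso e')⟩⟩

theorem addClosure_le_iff {P Q : ObjectProperty C} [IsAddClosed Q] :
    addClosure P ≤ Q ↔ P ≤ Q :=
  ⟨(le_addClosure P).trans, fun h _ ⟨_, f, hf, ⟨r⟩⟩ =>
    Q.prop_of_retract r (IsAddClosed.biproduct f fun i => h _ (hf i))⟩

/-- `add U` for a single object `U`. -/
abbrev addObj (U : C) : ObjectProperty C := addClosure fun X => X = U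

theorem addObj_self (U : C) : addObj U U := le_addClosure _ _ rfl

theorem addObj_le_iff {U : C} {Q : ObjectProperty C} [IsAddClosed Q] : addObj U ≤ Q ↔ Q U :=
  addClosure_le_iff.trans ⟨fun h => h U rfl, fun h _ hX => hX ▸ h⟩

theorem addObj_le_addObj_biprod_left (U V : C) : addObj U ≤ addObj (U ⊞ V) :=
  addObj_le_iff.2
    ((addObj (U ⊞ V)).prop_of_retract ⟨biprod.inl, biprod.fst, by simp⟩ (addObj_self _))

theorem addObj_le_addObj_biprod_right (U V : C) : addObj V ≤ addObj (U ⊞ V) :=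
  addObj_le_iff.2
    ((addObj (U ⊞ V)).prop_of_retract ⟨biprod.inr, biprod.snd, by simp⟩ (addObj_self _))

end AddClosure

section ShortExactSeq

universe v u' v'

variable {C : Type u} [Category.{v} C] [Abelian C] {D : Type u'} [Category.{v'} D] [Abelian D]

/-- There is a short exact sequence `0 ⟶ X ⟶ Y ⟶ Z ⟶ 0`. -/
def ShortExactSeq (X Y Z : C) : Prop :=
  ∃ (i : X ⟶ Y) (p : Y ⟶ Z) (w : i ≫ p = 0), (ShortComplex.mk i p w).ShortExact

theorem shortExact_of_lift {X Y Z : C} (i : X ⟶ Y) (p : Y ⟶ Z) (w : i ≫ p = 0) [Mono i] [Epi p]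
    (h : ∀ ⦃W : C⦄ (g : W ⟶ Y), g ≫ p = 0 → ∃ l : W ⟶ X, l ≫ i = g) :
    (ShortComplex.mk i p w).ShortExact where
  exact := ShortComplex.exact_of_f_is_kernel _
    (KernelFork.IsLimit.ofι' _ _ fun g hg => ⟨(h g hg).choose, (h g hg).choose_spec⟩)

theorem shortExact_of_desc {X Y Z : C} (i : X ⟶ Y) (p : Y ⟶ Z) (w : i ≫ p = 0) [Mono i] [Epi p]
    (h : ∀ ⦃W : C⦄ (g : Y ⟶ W), i ≫ g = 0 → ∃ l : Z ⟶ W, p ≫ l = g) :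
    (ShortComplex.mk i p w).ShortExact where
  exact := ShortComplex.exact_of_g_is_cokernel _
    (CokernelCofork.IsColimit.ofπ' _ _ fun g hg => ⟨(h g hg).choose, (h g hg).choose_spec⟩)

theorem exists_lift_of_shortExact {X Y Z W : C} {i : X ⟶ Y} {p : Y ⟶ Z} {w : i ≫ p = 0}
    (h : (ShortComplex.mk i p w).ShortExact) (g : W ⟶ Y) (hg : g ≫ p = 0) :
    ∃ l : W ⟶ X, l ≫ i = g :=
  ⟨_, (KernelFork.IsLimit.lift' h.fIsKernel g hg).2⟩

theorem exists_desc_of_shortExact {X Y Z W : C} {i : X ⟶ Y} {p : Y ⟶ Z} {w : i ≫ p = 0}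
    (h : (ShortComplex.mk i p w).ShortExact) (g : Y ⟶ W) (hg : i ≫ g = 0) :
    ∃ l : Z ⟶ W, p ≫ l = g :=
  ⟨_, (CokernelCofork.IsColimit.desc' h.gIsCokernel g hg).2⟩

theorem shortExact_pullback {X Y Z Z' : C} {i : X ⟶ Y} {p : Y ⟶ Z} {w : i ≫ p = 0}
    (h : (ShortComplex.mk i p w).ShortExact) (f : Z' ⟶ Z) :
    (ShortComplex.mk (pullback.lift i (0 : X ⟶ Z') (by simp [w])) (pullback.snd p f)
      (pullback.lift_snd _ _ _)).ShortExact := by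
  have : Mono i := h.mono_f
  have : Epi p := h.epi_g
  have : Mono (pullback.lift i (0 : X ⟶ Z') (by simp [w]) : X ⟶ pullback p f) :=
    mono_of_mono_fac (pullback.lift_fst _ _ _)
  refine shortExact_of_lift _ _ _ fun W g hg => ?_
  obtain ⟨l, hl⟩ := exists_lift_of_shortExact h (g ≫ pullback.fst p f)
    (by rw [Category.assoc, pullback.condition, reassoc_of% hg, zero_comp])
  exact ⟨l, pullback.hom_ext (by rw [Category.assoc, pullback.lift_fst, hl])
    (by rw [Category.assoc, pullback.lift_snd, comp_zero, hg])⟩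

theorem shortExact_pushout {X X' Y Z : C} {i : X ⟶ Y} {p : Y ⟶ Z} {w : i ≫ p = 0}
    (h : (ShortComplex.mk i p w).ShortExact) (f : X ⟶ X') :
    (ShortComplex.mk (pushout.inr i f) (pushout.desc p (0 : X' ⟶ Z) (by simp [w]))
      (pushout.inr_desc _ _ _)).ShortExact := by
  have : Mono i := h.mono_f
  have : Epi p := h.epi_g
  have : Epi (pushout.desc p (0 : X' ⟶ Z) (by simp [w]) : pushout i f ⟶ Z) :=
    epi_of_epi_fac (pushout.inl_desc _ _ _)
  refine shortExact_of_desc _ _ _ fun W g hg => ?_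
  obtain ⟨l, hl⟩ := exists_desc_of_shortExact h (pushout.inl i f ≫ g)
    (by rw [pushout.condition_assoc, hg, comp_zero])
  exact ⟨l, pushout.hom_ext (by rw [pushout.inl_desc_assoc, hl])
    (by rw [pushout.inr_desc_assoc, zero_comp, hg])⟩

theorem shortExactSeq_kernel {Y Z : C} (p : Y ⟶ Z) [Epi p] : ShortExactSeq (kernel p) Y Z :=
  ⟨kernel.ι p, p, kernel.condition p,
    shortExact_of_lift _ _ _ fun _ g hg => ⟨kernel.lift p g hg, by simp⟩⟩

namespace ShortExactSeq

variable {X Y Z : C}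

theorem of_iso {X' Y' Z' : C} (h : ShortExactSeq X Y Z) (eX : X ≅ X') (eY : Y ≅ Y')
    (eZ : Z ≅ Z') : ShortExactSeq X' Y' Z' := by
  obtain ⟨i, p, w, h⟩ := h
  exact ⟨eX.inv ≫ i ≫ eY.hom, eY.inv ≫ p ≫ eZ.hom, by simp [reassoc_of% w],
    ShortComplex.shortExact_of_iso (ShortComplex.isoMk eX eY eZ (by simp) (by simp)) h⟩

theorem map (h : ShortExactSeq X Y Z) (F : C ⥤ D) [F.Additive] [PreservesFiniteLimits F]
    [PreservesFiniteColimits F] : ShortExactSeq (F.obj X) (F.obj Y) (F.obj Z) := by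
  obtain ⟨i, p, w, h⟩ := h
  exact ⟨F.map i, F.map p, by rw [← F.map_comp, w, F.map_zero], h.map_of_exact F⟩

theorem of_isZero_left (hX : IsZero X) (e : Y ≅ Z) : ShortExactSeq X Y Z :=
  have : Mono (0 : X ⟶ Y) := ⟨fun _ _ _ => hX.eq_of_tgt _ _⟩
  ⟨0, e.hom, zero_comp, shortExact_of_lift _ _ _ fun _ g hg =>
    ⟨0, by rw [← cancel_mono e.hom, hg]; simp⟩⟩

theorem of_isZero_right (hZ : IsZero Z) (e : X ≅ Y) : ShortExactSeq X Y Z :=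
  have : Epi (0 : Y ⟶ Z) := ⟨fun _ _ _ => hZ.eq_of_src _ _⟩
  ⟨e.hom, 0, comp_zero, shortExact_of_lift _ _ _ fun _ g _ => ⟨g ≫ e.inv, by simp⟩⟩

theorem nonempty_iso_of_isZero_left (h : ShortExactSeq X Y Z) (hX : IsZero X) :
    Nonempty (Y ≅ Z) := by
  obtain ⟨i, p, w, h⟩ := h
  have : IsIso p := h.isIso_g_iff.2 hX
  exact ⟨asIso p⟩

theorem nonempty_iso_of_isZero_right (h : ShortExactSeq X Y Z) (hZ : IsZero Z) :
    Nonempty (X ≅ Y) := by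
  obtain ⟨i, p, w, h⟩ := h
  have : IsIso i := h.isIso_f_iff.2 hZ
  exact ⟨asIso i⟩

attribute [local instance] Abelian.hasFiniteBiproducts

theorem biprod {X' Y' Z' : C} (h : ShortExactSeq X Y Z) (h' : ShortExactSeq X' Y' Z') :
    ShortExactSeq (X ⊞ X') (Y ⊞ Y') (Z ⊞ Z') := by
  obtain ⟨i, p, w, h⟩ := h
  obtain ⟨i', p', w', h'⟩ := h'
  have : Mono i := h.mono_f
  have : Epi p := h.epi_g
  have : Mono i' := h'.mono_f
  have : Epi p' := h'.epi_g
  refine ⟨biprod.map i i', biprod.map p p', by ext <;> simp [w, w'],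
    shortExact_of_lift _ _ _ fun W g hg => ?_⟩
  obtain ⟨l, hl⟩ := exists_lift_of_shortExact h (g ≫ biprod.fst)
    (by simpa using congr($hg ≫ biprod.fst))
  obtain ⟨l', hl'⟩ := exists_lift_of_shortExact h' (g ≫ biprod.snd)
    (by simpa using congr($hg ≫ biprod.snd))
  exact ⟨biprod.lift l l', by ext <;> simp [hl, hl']⟩

theorem biprod_id (h : ShortExactSeq X Y Z) (P : C) : ShortExactSeq X (Y ⊞ P) (Z ⊞ P) :=
  (h.biprod (of_isZero_left (isZero_zero C) (Iso.refl P))).of_iso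
    (isoBiprodZero (isZero_zero C)).symm (Iso.refl _) (Iso.refl _)

theorem exists_kernel_comp {K L A : C} (h : ShortExactSeq K X Y) (h' : ShortExactSeq L Y A) :
    ∃ E, ShortExactSeq E X A ∧ ShortExactSeq K E L := by
  obtain ⟨i, p, w, h⟩ := h
  obtain ⟨j, q, w', h'⟩ := h'
  have : Epi p := h.epi_g
  have : Mono j := h'.mono_f
  have : Epi q := h'.epi_g
  refine ⟨pullback p j, ⟨pullback.fst p j, p ≫ q,
    by rw [pullback.condition_assoc, w', comp_zero], shortExact_of_lift _ _ _ fun W g hg => ?_⟩,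
    ⟨_, _, _, shortExact_pullback h j⟩⟩
  obtain ⟨l, hl⟩ := exists_lift_of_shortExact h' (g ≫ p) (by simpa using hg)
  exact ⟨pullback.lift g l hl.symm, pullback.lift_fst _ _ _⟩

theorem exists_cokernel_comp {A Q R : C} (h : ShortExactSeq X Y Q) (h' : ShortExactSeq Y A R) :
    ∃ E, ShortExactSeq X A E ∧ ShortExactSeq Q E R := by
  obtain ⟨i, p, w, h⟩ := h
  obtain ⟨j, q, w', h'⟩ := h'
  have : Mono i := h.mono_f
  have : Epi p := h.epi_g
  have : Mono j := h'.mono_f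
  refine ⟨pushout j p, ⟨i ≫ j, pushout.inl j p,
    by rw [Category.assoc, pushout.condition, reassoc_of% w, zero_comp],
    shortExact_of_desc _ _ _ fun W g hg => ?_⟩, ⟨_, _, _, shortExact_pushout h' p⟩⟩
  obtain ⟨l, hl⟩ := exists_desc_of_shortExact h (j ≫ g) (by simpa using hg)
  exact ⟨pushout.desc g l hl.symm, pushout.inl_desc _ _ _⟩

theorem exists_retract_of_retract_left {E : C} (h : ShortExactSeq X Y Z) (r : Retract X E) :
    ∃ Y', ShortExactSeq E Y' Z ∧ Nonempty (Retract Y Y') := by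
  obtain ⟨i, p, w, h⟩ := h
  exact ⟨_, ⟨_, _, _, shortExact_pushout h r.i⟩,
    ⟨pushout.inl i r.i, pushout.desc (𝟙 Y) (r.r ≫ i) (by simp), pushout.inl_desc _ _ _⟩⟩

/-- In the pullback `E` of `Y ⟶ Z` and `Q ⟶ Z`, the kernel `X` of `E ⟶ Q` splits off. -/
theorem rotate {Z' Q : C} [Projective Q] (h : ShortExactSeq X Y Z) (h' : ShortExactSeq Z' Q Z) :
    ShortExactSeq Z' (X ⊞ Q) Y := by
  obtain ⟨i, p, w, h⟩ := h
  obtain ⟨j, q, w', h'⟩ := h'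
  let e : pullback p q ≅ X ⊞ Q := ShortComplex.Splitting.isoBinaryBiproduct
    (ShortComplex.ShortExact.splittingOfProjective (shortExact_pullback h q))
  have hE : ShortExactSeq Z' (pullback q p) Y := ⟨_, _, _, shortExact_pullback h' p⟩
  exact hE.of_iso (Iso.refl _) (pullbackSymmetry q p ≪≫ e) (Iso.refl _)

theorem nonempty_retract_of_retract_right {X' Y' Z' : C} [Projective Y] [Projective Y']
    (h : ShortExactSeq X Y Z) (h' : ShortExactSeq X' Y' Z') (r : Retract Z Z') :
    Nonempty (Retract X (X' ⊞ Y)) := by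
  obtain ⟨i, p, w, h⟩ := h
  obtain ⟨j, q, w', h'⟩ := h'
  have : Mono i := h.mono_f
  have : Epi p := h.epi_g
  have : Epi q := h'.epi_g
  let s : Y ⟶ Y' := Projective.factorThru (p ≫ r.i) q
  have hs : s ≫ q = p ≫ r.i := Projective.factorThru_comp _ _
  let t : Y' ⟶ Y := Projective.factorThru (q ≫ r.r) p
  have ht : t ≫ p = q ≫ r.r := Projective.factorThru_comp _ _
  obtain ⟨a, ha⟩ := exists_lift_of_shortExact h' (i ≫ s) (by simp [hs, reassoc_of% w])
  obtain ⟨b, hb⟩ := exists_lift_of_shortExact h (j ≫ t) (by simp [ht, reassoc_of% w'])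
  obtain ⟨c, hc⟩ := exists_lift_of_shortExact h (𝟙 Y - s ≫ t)
    (by simp [Preadditive.sub_comp, ht, reassoc_of% hs])
  refine ⟨⟨biprod.lift a i, biprod.desc b c, ?_⟩⟩
  rw [← cancel_mono i, biprod.lift_desc, Preadditive.add_comp, Category.assoc, Category.assoc,
    hb, hc, reassoc_of% ha, Preadditive.comp_sub, Category.comp_id, Category.id_comp,
    add_sub_cancel]

end ShortExactSeq

end ShortExactSeq

section ENatInfimum

theorem iInf_natCast_le_of_imp {P Q : ℕ → Prop} (h : ∀ m, Q m → P m) :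
    (⨅ (m : ℕ) (_ : P m), (m : ℕ∞)) ≤ ⨅ (m : ℕ) (_ : Q m), (m : ℕ∞) :=
  le_iInf₂ fun m hm => iInf₂_le m (h m hm)

theorem iInf_natCast_le_mul {P Q : ℕ → Prop} {n : ℕ} (hn : 1 ≤ n)
    (h : ∀ m, Q m → P (n * (m + 1) - 1)) :
    (⨅ (m : ℕ) (_ : P m), (m : ℕ∞)) ≤ n * ((⨅ (m : ℕ) (_ : Q m), (m : ℕ∞)) + 1) - 1 := by
  classical
  by_cases hQ : ∃ m, Q m
  · have hmin : (⨅ (m : ℕ) (_ : Q m), (m : ℕ∞)) = (Nat.find hQ : ℕ) :=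
      le_antisymm (iInf₂_le _ (Nat.find_spec hQ))
        (le_iInf₂ fun m hm => by exact_mod_cast Nat.find_min' hQ hm)
    rw [hmin]
    refine (iInf₂_le _ (h _ (Nat.find_spec hQ))).trans ?_
    norm_cast
  · have htop : (⨅ (m : ℕ) (_ : Q m), (m : ℕ∞)) = ⊤ := by
      simp only [iInf_eq_top]
      exact fun m hm => (hQ ⟨m, hm⟩).elim
    have hn' : (n : ℕ∞) ≠ 0 := by exact_mod_cast Nat.one_le_iff_ne_zero.1 hn
    rw [htop, top_add, ENat.mul_top hn']
    exact le_top

end ENatInfimum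

section ExtensionDimension

universe v v' u'

attribute [local instance] Abelian.hasFiniteBiproducts

variable {C : Type u} [Category.{v} C] [Abelian C] {D : Type u'} [Category.{v'} D] [Abelian D]
  {P Q : ObjectProperty C}

theorem extensionProduct_of_shortExactSeq {X A Y : C} (h : ShortExactSeq X A Y) (hX : P X)
    (hY : Q Y) : extensionProduct P Q A :=
  let ⟨i, p, w, h⟩ := h
  le_addClosure _ _ ⟨X, Y, i, p, w, hX, hY, h⟩

theorem extensionProduct_iff [IsAddClosed P] [IsAddClosed Q] {A : C} :
    extensionProduct P Q A ↔
      ∃ X E Y, Nonempty (Retract A E) ∧ ShortExactSeq X E Y ∧ P X ∧ Q Y := by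
  constructor
  · let S : ObjectProperty C := fun A =>
      ∃ X E Y, Nonempty (Retract A E) ∧ ShortExactSeq X E Y ∧ P X ∧ Q Y
    have : S.IsStableUnderRetracts :=
      ⟨fun r ⟨X, E, Y, ⟨s⟩, h⟩ => ⟨X, E, Y, ⟨r.trans s⟩, h⟩⟩
    have : IsAddClosed S := by
      refine .of_isZero_of_biprod (fun X hX => ⟨X, X, X, ⟨.refl X⟩,
        .of_isZero_left hX (Iso.refl X), P.prop_of_isZero hX, Q.prop_of_isZero hX⟩) ?_
      rintro A A' ⟨X, E, Y, ⟨r⟩, h, hX, hY⟩ ⟨X', E', Y', ⟨r'⟩, h', hX', hY'⟩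
      exact ⟨X ⊞ X', E ⊞ E', Y ⊞ Y', ⟨⟨biprod.map r.i r'.i, biprod.map r.r r'.r, by ext <;> simp⟩⟩,
        h.biprod h', IsAddClosed.biprod hX hX', IsAddClosed.biprod hY hY'⟩
    refine addClosure_le_iff (Q := S).2 ?_ A
    rintro A ⟨X, Y, i, p, w, hX, hY, h⟩
    exact ⟨X, A, Y, ⟨.refl A⟩, ⟨i, p, w, h⟩, hX, hY⟩
  · rintro ⟨X, E, Y, ⟨r⟩, h, hX, hY⟩
    exact (addClosure _).prop_of_retract r (extensionProduct_of_shortExactSeq h hX hY)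

instance : ∀ n, IsAddClosed (extensionPower P n)
  | 0 =>
    have : (extensionPower P 0).IsStableUnderRetracts := ⟨fun r (h : IsZero _) =>
      (IsZero.iff_id_eq_zero _).2 (by rw [← r.retract, h.eq_of_tgt r.i 0, zero_comp])⟩
    .of_isZero_of_biprod (fun _ h => h) fun _ _ hX hY => (biprod_isZero_iff _ _).2 ⟨hX, hY⟩
  | 1 => inferInstanceAs (IsAddClosed (addClosure P))
  | n + 2 => by
    rw [extensionPower]
    exact inferInstanceAs (IsAddClosed (addClosure _))

theorem extensionPower_succ_iff {n : ℕ} {A : C} :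
    extensionPower P (n + 1) A ↔ ∃ X E Y, Nonempty (Retract A E) ∧ ShortExactSeq X E Y ∧
      addClosure P X ∧ extensionPower P n Y := by
  cases n with
  | zero =>
    refine ⟨fun hA => ⟨A, A, 0, ⟨.refl A⟩, .of_isZero_right (isZero_zero C) (Iso.refl A), hA,
      isZero_zero C⟩, ?_⟩
    rintro ⟨X, E, Y, ⟨r⟩, h, hX, hY⟩
    obtain ⟨e⟩ := h.nonempty_iso_of_isZero_right hY
    exact (addClosure P).prop_of_retract r ((addClosure P).prop_of_iso e hX)
  | succ n => rw [extensionPower, extensionProduct_iff]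

theorem extensionPower_add {a b : ℕ} {X A Y : C} (h : ShortExactSeq X A Y)
    (hX : extensionPower P a X) (hY : extensionPower P b Y) : extensionPower P (a + b) A := by
  induction a generalizing X A Y with
  | zero =>
    obtain ⟨e⟩ := h.nonempty_iso_of_isZero_left hX
    rw [zero_add]
    exact (extensionPower P b).prop_of_iso e.symm hY
  | succ a ih =>
    obtain ⟨X', E, X'', ⟨r⟩, hE, hX', hX''⟩ := extensionPower_succ_iff.1 hX
    obtain ⟨A', hA', s⟩ := h.exists_retract_of_retract_left r
    obtain ⟨W, hW, hW'⟩ := hE.exists_cokernel_comp hA'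
    rw [Nat.add_right_comm]
    exact extensionPower_succ_iff.2 ⟨_, _, _, s, hW, hX', ih hW' hX'' hY⟩

theorem extensionPower_map (F : C ⥤ D) [F.Additive] [PreservesFiniteLimits F]
    [PreservesFiniteColimits F] {R : ObjectProperty D} (h : P ≤ (addClosure R).inverseImage F)
    {n : ℕ} {X : C} (hX : extensionPower P n X) : extensionPower R n (F.obj X) := by
  induction n generalizing X with
  | zero => exact F.map_isZero hX
  | succ n ih =>
    obtain ⟨X', E, X'', ⟨r⟩, hE, hX', hX''⟩ := extensionPower_succ_iff.1 hX
    exact extensionPower_succ_iff.2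
      ⟨_, _, _, ⟨r.map F⟩, hE.map F, addClosure_le_iff.2 h _ hX', ih hX''⟩

theorem extensionPower_eq_map (F : C ⥤ D) [F.Additive] [PreservesFiniteLimits F]
    [PreservesFiniteColimits F] {T : C} {n : ℕ} {X : C}
    (hX : extensionPower (fun X => X = T) n X) :
    extensionPower (fun X => X = F.obj T) n (F.obj X) :=
  extensionPower_map F (fun _ h => h ▸ addObj_self (F.obj T)) hX

theorem extensionDimension_le_of_essSurj (F : C ⥤ D) [F.Additive] [PreservesFiniteLimits F]
    [PreservesFiniteColimits F] [F.EssSurj] : extensionDimension D ≤ extensionDimension C := by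
  refine iInf_natCast_le_of_imp ?_
  rintro m ⟨T, hT⟩
  exact ⟨F.obj T, fun A => (extensionPower _ _).prop_of_iso (F.objObjPreimageIso A)
    (extensionPower_eq_map F (hT _))⟩

end ExtensionDimension

section NilpotentLength

universe v v' u'

variable {A : Type u} [Category.{v} A] {B : Type u'} [Category.{v'} B] [Abelian B]
  {L : B ⥤ A} {Z : A ⥤ B}

/-- `HasNilpotentLength η k X` says that `k` successive passages to the kernel of `η` annihilate
`X`. If `η` consists of epimorphisms, then the iterated kernels form a filtration of `X` of length
`k` whose layers are in the essential image of `Z`. -/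
def HasNilpotentLength (η : 𝟭 B ⟶ L ⋙ Z) : ℕ → B → Prop
  | 0, X => IsZero X
  | k + 1, X => HasNilpotentLength η k (kernel (η.app X))

theorem HasNilpotentLength.of_iso {η : 𝟭 B ⟶ L ⋙ Z} {k : ℕ} {X Y : B}
    (hX : HasNilpotentLength η k X) (e : X ≅ Y) : HasNilpotentLength η k Y := by
  induction k generalizing X Y with
  | zero => exact IsZero.of_iso hX e.symm
  | succ k ih =>
    exact ih hX (kernel.mapIso (η.app X) (η.app Y) e ((L ⋙ Z).mapIso e) (η.naturality e.hom).symm)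

variable [Abelian A] (η : 𝟭 B ⟶ L ⋙ Z) [∀ X, Epi (η.app X)] [Z.Additive]
  [PreservesFiniteLimits Z] [PreservesFiniteColimits Z]

theorem extensionPower_of_hasNilpotentLength {T : A} {m : ℕ}
    (hT : ∀ X, extensionPower (fun X => X = T) m X) {k : ℕ} {X : B}
    (hX : HasNilpotentLength η k X) : extensionPower (fun X => X = Z.obj T) (k * m) X := by
  induction k generalizing X with
  | zero =>
    rw [zero_mul]
    exact hX
  | succ k ih =>
    rw [add_mul, one_mul]
    exact extensionPower_add (shortExactSeq_kernel (η.app X)) (ih hX)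
      (extensionPower_eq_map Z (hT _))

theorem extensionDimension_le_mul {n : ℕ} (hn : 1 ≤ n)
    (hnil : ∀ X, HasNilpotentLength η n X) :
    extensionDimension B ≤ n * (extensionDimension A + 1) - 1 := by
  refine iInf_natCast_le_mul hn ?_
  rintro m ⟨T, hT⟩
  refine ⟨Z.obj T, fun X => ?_⟩
  rw [Nat.sub_add_cancel (Nat.mul_pos hn m.succ_pos)]
  exact extensionPower_of_hasNilpotentLength η hT (hnil X)

end NilpotentLength

section IgusaTodorov

universe v v' u'

attribute [local instance] Abelian.hasFiniteBiproducts

variable {C : Type u} [Category.{v} C] [Abelian C] {D : Type u'} [Category.{v'} D] [Abelian D]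

theorem hasAddResolution_succ_iff {U A : C} {m : ℕ} :
    HasAddResolution U (m + 1) A ↔
      ∃ K U₀, addObj U U₀ ∧ ShortExactSeq K U₀ A ∧ HasAddResolution U m K :=
  ⟨fun ⟨K, U₀, i, p, w, hU₀, h, hK⟩ => ⟨K, U₀, hU₀, ⟨i, p, w, h⟩, hK⟩,
    fun ⟨K, U₀, hU₀, ⟨i, p, w, h⟩, hK⟩ => ⟨K, U₀, i, p, w, hU₀, h, hK⟩⟩

theorem isSyzygy_succ_iff {n : ℕ} {A K : C} :
    IsSyzygy (n + 1) A K ↔ ∃ L P, IsSyzygy n A L ∧ Projective P ∧ ShortExactSeq K P L :=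
  ⟨fun ⟨L, P, i, p, w, hL, hP, h⟩ => ⟨L, P, hL, hP, ⟨i, p, w, h⟩⟩,
    fun ⟨L, P, hL, hP, ⟨i, p, w, h⟩⟩ => ⟨L, P, i, p, w, hL, hP, h⟩⟩

theorem HasAddResolution.map (F : C ⥤ D) [F.Additive] [PreservesFiniteLimits F]
    [PreservesFiniteColimits F] {U A : C} {V : D} (hV : addObj V (F.obj U)) {m : ℕ}
    (hA : HasAddResolution U m A) : HasAddResolution V m (F.obj A) := by
  have hF : addObj U ≤ (addObj V).inverseImage F := addObj_le_iff.2 hV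
  induction m generalizing A with
  | zero => exact hF _ hA
  | succ m ih =>
    obtain ⟨K, U₀, hU₀, h, hK⟩ := hasAddResolution_succ_iff.1 hA
    exact hasAddResolution_succ_iff.2 ⟨_, _, hF _ hU₀, h.map F, ih hK⟩

theorem HasAddResolution.biprod_left {U A : C} {m : ℕ} (hA : HasAddResolution U m A) (V : C) :
    HasAddResolution (U ⊞ V) m A :=
  hA.map (𝟭 C) (addObj_le_addObj_biprod_left U V _ (addObj_self U))

theorem HasAddResolution.biprod_right {V A : C} {m : ℕ} (hA : HasAddResolution V m A) (U : C) :
    HasAddResolution (U ⊞ V) m A :=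
  hA.map (𝟭 C) (addObj_le_addObj_biprod_right U V _ (addObj_self V))

theorem IsSyzygy.map (F : C ⥤ D) [F.Additive] [PreservesFiniteLimits F]
    [PreservesFiniteColimits F] [F.PreservesProjectiveObjects] {n : ℕ} {A K : C}
    (hK : IsSyzygy n A K) : IsSyzygy n (F.obj A) (F.obj K) := by
  induction n generalizing K with
  | zero =>
    obtain ⟨e⟩ := hK
    exact ⟨F.mapIso e⟩
  | succ n ih =>
    obtain ⟨L, P, hL, _, h⟩ := isSyzygy_succ_iff.1 hK
    exact isSyzygy_succ_iff.2 ⟨_, _, ih hL, F.projective_obj P, h.map F⟩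

theorem IsSyzygy.of_iso {n : ℕ} {A B K : C} (hK : IsSyzygy n A K) (e : A ≅ B) :
    IsSyzygy n B K := by
  induction n generalizing K with
  | zero =>
    obtain ⟨e'⟩ := hK
    exact ⟨e' ≪≫ e⟩
  | succ n ih =>
    obtain ⟨L, P, hL, hP, h⟩ := isSyzygy_succ_iff.1 hK
    exact isSyzygy_succ_iff.2 ⟨_, _, ih hL, hP, h⟩

theorem igusaTodorovDistance_le_of_essSurj (F : C ⥤ D) [F.Additive] [PreservesFiniteLimits F]
    [PreservesFiniteColimits F] [F.PreservesProjectiveObjects] [F.EssSurj] :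
    igusaTodorovDistance D ≤ igusaTodorovDistance C := by
  refine iInf_natCast_le_of_imp ?_
  rintro m ⟨n, U, hU⟩
  refine ⟨n, F.obj U, fun A => ?_⟩
  obtain ⟨K, hK, hKU⟩ := hU (F.objPreimage A)
  exact ⟨F.obj K, (hK.map F).of_iso (F.objObjPreimageIso A), hKU.map F (addObj_self _)⟩

theorem exists_isSyzygy_of_shortExactSeq {n : ℕ} {X Y Z K M : C} (h : ShortExactSeq X Y Z)
    (hK : IsSyzygy n X K) (hM : IsSyzygy n Z M) :
    ∃ E, IsSyzygy n Y E ∧ ShortExactSeq K E M := by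
  induction n generalizing K M with
  | zero =>
    obtain ⟨e⟩ := hK
    obtain ⟨e'⟩ := hM
    exact ⟨Y, ⟨Iso.refl Y⟩, h.of_iso e.symm (Iso.refl Y) e'.symm⟩
  | succ n ih =>
    obtain ⟨L, P, hL, _, hKL⟩ := isSyzygy_succ_iff.1 hK
    obtain ⟨L', P', hL', _, hML'⟩ := isSyzygy_succ_iff.1 hM
    obtain ⟨N, hN, hLN⟩ := ih hL hL'
    obtain ⟨E, hE, hKE⟩ := (hKL.biprod_id P').exists_kernel_comp (hLN.rotate hML')
    exact ⟨E, isSyzygy_succ_iff.2 ⟨N, _, hN, inferInstance, hE⟩, hKE⟩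

/-- A *progenerator*: a projective object `G` such that every object is a quotient of an object
of `add G`. -/
structure IsProgenerator (G : C) : Prop where
  projective : Projective G
  exists_shortExactSeq (X : C) : ∃ K P, addObj G P ∧ ShortExactSeq K P X

namespace IsProgenerator

variable {G : C} (hG : IsProgenerator G)

include hG

theorem projective_of_addObj {P : C} (hP : addObj G P) : Projective P :=
  addObj_le_iff (Q := CategoryTheory.isProjective C).2 hG.projective _ hP

theorem enoughProjectives : EnoughProjectives C where
  presentation X :=
    let ⟨_, P, hP, ⟨_, p, _, h⟩⟩ := hG.exists_shortExactSeq X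
    ⟨{ p := P, projective := hG.projective_of_addObj hP, f := p, epi := h.epi_g }⟩

theorem exists_shortExactSeq_of_addObj {S Q V A : C} (hS : ShortExactSeq S Q V)
    (hQ : addObj G Q) (hA : addObj V A) :
    ∃ K P, addObj G P ∧ ShortExactSeq K P A ∧ addObj (S ⊞ G) K := by
  let R : ObjectProperty C := fun A =>
    ∃ K P, addObj G P ∧ ShortExactSeq K P A ∧ addObj (S ⊞ G) K
  have : R.IsStableUnderRetracts := by
    refine ⟨fun {X Y} r ⟨K, P, hP, h, hK⟩ => ?_⟩
    obtain ⟨K', P', hP', h'⟩ := hG.exists_shortExactSeq X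
    have := hG.projective_of_addObj hP
    have := hG.projective_of_addObj hP'
    obtain ⟨s⟩ := h'.nonempty_retract_of_retract_right h r
    exact ⟨K', P', hP', h', (addObj (S ⊞ G)).prop_of_retract s
      (IsAddClosed.biprod hK (addObj_le_addObj_biprod_right S G _ hP'))⟩
  have : IsAddClosed R := .of_isZero_of_biprod
    (fun X hX => ⟨X, X, (addObj G).prop_of_isZero hX, .of_isZero_left hX (Iso.refl X),
      (addObj (S ⊞ G)).prop_of_isZero hX⟩)
    fun X Y ⟨_, _, hP, h, hK⟩ ⟨_, _, hP', h', hK'⟩ =>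
      ⟨_, _, IsAddClosed.biprod hP hP', h.biprod h', IsAddClosed.biprod hK hK'⟩
  exact addObj_le_iff (Q := R).2
    ⟨S, Q, hQ, hS, addObj_le_addObj_biprod_left S G _ (addObj_self S)⟩ _ hA

theorem exists_syzygy_hasAddResolution (V : C) :
    ∃ V', ∀ (m : ℕ) (A : C), HasAddResolution V m A →
      ∃ K P, addObj G P ∧ ShortExactSeq K P A ∧ HasAddResolution V' m K := by
  obtain ⟨S, Q, hQ, hS⟩ := hG.exists_shortExactSeq V
  refine ⟨S ⊞ G, fun m => ?_⟩
  induction m with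
  | zero => exact fun A hA => hG.exists_shortExactSeq_of_addObj hS hQ hA
  | succ m ih =>
    intro A hA
    obtain ⟨K, U, hU, hKU, hK⟩ := hasAddResolution_succ_iff.1 hA
    obtain ⟨K', P, hP, hK'P, hK'⟩ := ih K hK
    obtain ⟨U', P₀, hP₀, hU'P₀, hU'⟩ := hG.exists_shortExactSeq_of_addObj hS hQ hU
    obtain ⟨E, hE, hU'E⟩ := hU'P₀.exists_kernel_comp hKU
    have := hG.projective_of_addObj hP
    exact ⟨E, P₀, hP₀, hE, hasAddResolution_succ_iff.2 ⟨K', U' ⊞ P,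
      IsAddClosed.biprod hU' (addObj_le_addObj_biprod_right S G _ hP), hU'E.rotate hK'P, hK'⟩⟩

theorem exists_hasAddResolution_of_shortExactSeq (U V : C) (a b : ℕ) :
    ∃ W, ∀ X Y Z : C, ShortExactSeq X Y Z → HasAddResolution U a X → HasAddResolution V b Z →
      HasAddResolution W (a + b + 1) Y := by
  obtain ⟨V', hV'⟩ := hG.exists_syzygy_hasAddResolution V
  have addObj_biprod {U₀ P : C} (hU₀ : addObj U U₀) (hP : addObj G P) :
      addObj (U ⊞ G) (U₀ ⊞ P) :=
    IsAddClosed.biprod (addObj_le_addObj_biprod_left U G _ hU₀)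
      (addObj_le_addObj_biprod_right U G _ hP)
  induction a generalizing V V' with
  | zero =>
    refine ⟨(U ⊞ G) ⊞ V', fun X Y Z h hX hZ => ?_⟩
    obtain ⟨K, P, hP, hKP, hK⟩ := hV' b Z hZ
    have := hG.projective_of_addObj hP
    rw [zero_add]
    exact hasAddResolution_succ_iff.2 ⟨K, X ⊞ P, addObj_le_addObj_biprod_left _ _ _
      (addObj_biprod hX hP), h.rotate hKP, hK.biprod_right _⟩
  | succ a ih =>
    obtain ⟨V'', hV''⟩ := hG.exists_syzygy_hasAddResolution V'
    obtain ⟨W, hW⟩ := ih V' V'' hV''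
    refine ⟨W ⊞ (U ⊞ G), fun X Y Z h hX hZ => ?_⟩
    obtain ⟨K, P, hP, hKP, hK⟩ := hV' b Z hZ
    have := hG.projective_of_addObj hP
    obtain ⟨X', U₀, hU₀, hX'U₀, hX'⟩ := hasAddResolution_succ_iff.1 hX
    obtain ⟨E, hE, hX'E⟩ := (hX'U₀.biprod_id P).exists_kernel_comp (h.rotate hKP)
    rw [Nat.add_right_comm a 1 b]
    exact hasAddResolution_succ_iff.2 ⟨E, U₀ ⊞ P, addObj_le_addObj_biprod_right _ _ _
      (addObj_biprod hU₀ hP), hE, (hW _ _ _ hX'E hX' hK).biprod_left _⟩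

end IsProgenerator

theorem ShortExactSeq.projective_of_hasProjectiveDimensionLE_one {X P Z : C} [Projective P]
    (h : ShortExactSeq X P Z) [HasProjectiveDimensionLE Z 1] : Projective X := by
  obtain ⟨i, p, w, h⟩ := h
  rw [projective_iff_hasProjectiveDimensionLT_one]
  exact (h.hasProjectiveDimensionLT_X₃_iff 0 inferInstance).1 ‹_›

theorem IsSyzygy.succ_map [EnoughProjectives D] (Z : C ⥤ D) [Z.Additive]
    [PreservesFiniteLimits Z] [PreservesFiniteColimits Z]
    (hZ : ∀ Q, Projective Q → HasProjectiveDimensionLE (Z.obj Q) 1) {t : ℕ} {A K : C}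
    (hK : IsSyzygy t A K) {K' P : D} [Projective P] (h : ShortExactSeq K' P (Z.obj K)) :
    IsSyzygy (t + 1) (Z.obj A) K' := by
  induction t generalizing K K' P with
  | zero =>
    obtain ⟨e⟩ := hK
    exact isSyzygy_succ_iff.2 ⟨Z.obj A, P, ⟨Iso.refl _⟩, inferInstance,
      h.of_iso (Iso.refl _) (Iso.refl _) (Z.mapIso e)⟩
  | succ t ih =>
    obtain ⟨L, Q, hL, hQ, hKQ⟩ := isSyzygy_succ_iff.1 hK
    have hQ' := shortExactSeq_kernel (Projective.π (Z.obj Q))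
    have := hZ Q hQ
    have := hQ'.projective_of_hasProjectiveDimensionLE_one
    obtain ⟨E, hE, hQ'E⟩ := hQ'.exists_kernel_comp (hKQ.map Z)
    exact isSyzygy_succ_iff.2 ⟨E, _, ih hL hE, inferInstance, hQ'E.rotate h⟩

variable {L : C ⥤ D} {Z : D ⥤ C} (η : 𝟭 C ⟶ L ⋙ Z) [∀ X, Epi (η.app X)] [Z.Additive]
  [PreservesFiniteLimits Z] [PreservesFiniteColimits Z] {G : C} (hG : IsProgenerator G)
  (hZ : ∀ Q, Projective Q → HasProjectiveDimensionLE (Z.obj Q) 1)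

include hG hZ

theorem IsProgenerator.exists_isSyzygy_succ_map {m t : ℕ} (h : IsIgusaTodorov D m t) :
    ∃ V, ∀ A, ∃ K, IsSyzygy (t + 1) (Z.obj A) K ∧ HasAddResolution V m K := by
  obtain ⟨U, hU⟩ := h
  obtain ⟨V, hV⟩ := hG.exists_syzygy_hasAddResolution (Z.obj U)
  refine ⟨V, fun A => ?_⟩
  obtain ⟨K, hK, hKU⟩ := hU A
  obtain ⟨K', P, hP, hK'P, hK'⟩ := hV m _ (hKU.map Z (addObj_self _))
  have := hG.projective_of_addObj hP
  have := hG.enoughProjectives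
  exact ⟨K', hK.succ_map Z hZ hK'P, hK'⟩

theorem exists_isSyzygy_of_hasNilpotentLength {m t : ℕ} (h : IsIgusaTodorov D m t) (k : ℕ) :
    ∃ W, ∀ X, HasNilpotentLength η (k + 1) X →
      ∃ K, IsSyzygy (t + 1) X K ∧ HasAddResolution W (k * (m + 1) + m) K := by
  obtain ⟨V, hV⟩ := hG.exists_isSyzygy_succ_map hZ h
  induction k with
  | zero =>
    refine ⟨V, fun X hX => ?_⟩
    obtain ⟨e⟩ := (shortExactSeq_kernel (η.app X)).nonempty_iso_of_isZero_left hX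
    obtain ⟨K, hK, hKV⟩ := hV (L.obj X)
    exact ⟨K, hK.of_iso e.symm, by rwa [zero_mul, zero_add]⟩
  | succ k ih =>
    obtain ⟨W, hW⟩ := ih
    obtain ⟨W', hW'⟩ :=
      hG.exists_hasAddResolution_of_shortExactSeq W V (k * (m + 1) + m) m
    refine ⟨W', fun X hX => ?_⟩
    obtain ⟨K, hK, hKW⟩ := hW _ hX
    obtain ⟨M, hM, hMV⟩ := hV (L.obj X)
    obtain ⟨E, hE, hKE⟩ :=
      exists_isSyzygy_of_shortExactSeq (shortExactSeq_kernel (η.app X)) hK hM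
    refine ⟨E, hE, ?_⟩
    rw [show (k + 1) * (m + 1) + m = k * (m + 1) + m + m + 1 by ring]
    exact hW' _ _ _ hKE hKW hMV

theorem igusaTodorovDistance_le_mul {n : ℕ} (hn : 1 ≤ n)
    (hnil : ∀ X, HasNilpotentLength η n X) :
    igusaTodorovDistance C ≤ n * (igusaTodorovDistance D + 1) - 1 := by
  refine iInf_natCast_le_mul hn ?_
  rintro m ⟨t, h⟩
  obtain ⟨k, rfl⟩ := Nat.exists_eq_add_of_le' hn
  obtain ⟨W, hW⟩ := exists_isSyzygy_of_hasNilpotentLength η hG hZ h k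
  refine ⟨t + 1, W, fun X => ?_⟩
  rw [show (k + 1) * (m + 1) - 1 = k * (m + 1) + m by rw [add_one_mul]; rfl]
  exact hW X (hnil X)

end IgusaTodorov

section ThickPower

universe v v' u'

variable {T : Type u} [Category.{v} T] [HasShift T ℤ] [Preadditive T]
  {T' : Type u'} [Category.{v'} T'] [HasShift T' ℤ] [Preadditive T'] {P : ObjectProperty T}

instance : ObjectProperty.IsStableUnderRetracts (thickOne P) :=
  ⟨fun r hY => .summand _ _ r hY⟩

instance : ObjectProperty.IsStableUnderShift (thickOne P) ℤ where
  isStableUnderShiftBy n := ⟨fun X hX => .shift X n hX⟩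

theorem thickOne_map (F : T ⥤ T') [F.CommShift ℤ] [F.Additive] {Q : ObjectProperty T'}
    (h : P ≤ ObjectProperty.inverseImage (thickOne Q) F) {X : T} (hX : thickOne P X) :
    thickOne Q (F.obj X) := by
  induction hX with
  | of X hX => exact h X hX
  | zero X hX => exact .zero _ (F.map_isZero hX)
  | directSum X Y S inl fst inr snd h₁ h₂ hS _ _ ihX ihY =>
    refine .directSum _ _ _ (F.map inl) (F.map fst) (F.map inr) (F.map snd) ?_ ?_ ?_ ihX ihY
    · rw [← F.map_comp, h₁, F.map_id]
    · rw [← F.map_comp, h₂, F.map_id]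
    · rw [← F.map_comp, ← F.map_comp, ← F.map_add, hS, F.map_id]
  | summand X Y r _ ih => exact .summand _ _ (r.map F) ih
  | shift X n _ ih =>
    exact .summand _ _ (.ofIso ((F.commShiftIso n).app X)) (.shift _ n ih)

theorem isZero_of_thickOne_bot [∀ n : ℤ, (shiftFunctor T n).Additive] {X : T}
    (hX : thickOne (⊥ : ObjectProperty T) X) : IsZero X := by
  induction hX with
  | of _ hX => exact hX.elim
  | zero _ hX => exact hX
  | directSum X Y S inl fst inr snd _ _ hS _ _ ihX ihY =>
    rw [IsZero.iff_id_eq_zero, ← hS, ihX.eq_of_tgt fst 0, ihY.eq_of_tgt snd 0, zero_comp,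
      zero_comp, add_zero]
  | summand X Y r _ ih => rw [IsZero.iff_id_eq_zero, ← r.retract, ih.eq_of_tgt r.i 0, zero_comp]
  | shift X n _ ih => exact (shiftFunctor T n).map_isZero ih

end ThickPower

section Pretriangulated

universe v v' u'

variable {T : Type u} [Category.{v} T] [HasZeroObject T] [HasShift T ℤ] [Preadditive T]
  [∀ n : ℤ, (shiftFunctor T n).Additive] [Pretriangulated T] {P Q : ObjectProperty T}

instance : ObjectProperty.ContainsZero (thickOne P) :=
  ⟨0, isZero_zero T, .zero _ (isZero_zero T)⟩

instance : ObjectProperty.IsClosedUnderFiniteProducts (thickOne P) :=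
  have : ObjectProperty.IsClosedUnderBinaryProducts (thickOne P) :=
    ⟨by
      rintro X ⟨p⟩
      let e := (BinaryBiproduct.isLimit _ _).conePointUniqueUpToIso
        ((IsLimit.postcomposeHomEquiv (diagramIsoPair p.diag) _).2 p.isLimit)
      exact ObjectProperty.prop_of_iso (thickOne P) e
        (.directSum _ _ _ biprod.inl biprod.fst biprod.inr biprod.snd biprod.inl_fst
          biprod.inr_snd biprod.total (p.prop_diag_obj _) (p.prop_diag_obj _))⟩
  .mk'

theorem thickOne_le_retractClosure [P.IsStableUnderShift ℤ] [P.IsClosedUnderFiniteProducts] :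
    thickOne P ≤ P.retractClosure := by
  intro X hX
  induction hX with
  | of X hX => exact P.le_retractClosure X hX
  | zero X hX => exact P.le_retractClosure X (P.prop_of_isTerminal X hX.isTerminal)
  | directSum X Y S inl fst inr snd _ _ hS _ _ ihX ihY =>
    obtain ⟨A, hA, ⟨r⟩⟩ := ihX
    obtain ⟨B, hB, ⟨s⟩⟩ := ihY
    refine ⟨A ⨯ B, P.prop_prod A B hA hB, ⟨⟨prod.lift (fst ≫ r.i) (snd ≫ s.i),
      prod.fst ≫ r.r ≫ inl + prod.snd ≫ s.r ≫ inr, ?_⟩⟩⟩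
    simp only [Preadditive.comp_add, prod.lift_fst_assoc, prod.lift_snd_assoc, Category.assoc,
      r.retract_assoc, s.retract_assoc, hS]
  | summand X Y r _ ih => exact P.retractClosure.prop_of_retract r ih
  | shift X n _ ih =>
    obtain ⟨A, hA, ⟨r⟩⟩ := ih
    exact ⟨A⟦n⟧, P.le_shift n A hA, ⟨r.map (shiftFunctor T n)⟩⟩

theorem triangleProduct_eq_extensionProduct (P Q : ObjectProperty T) :
    triangleProduct P Q = P.extensionProduct Q := by
  ext A
  constructor
  · rintro ⟨X, Y, f, g, h, hX, hY, hT⟩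
    exact ⟨X, Y, f, g, h, hT, hX, hY⟩
  · rintro ⟨X, Y, f, g, h, hT, hX, hY⟩
    exact ⟨X, Y, f, g, h, hX, hY, hT⟩

instance [P.IsStableUnderShift ℤ] [Q.IsStableUnderShift ℤ] :
    (P.extensionProduct Q).IsStableUnderShift ℤ where
  isStableUnderShiftBy n := ⟨by
    rintro A ⟨X, Y, f, g, h, hT, hX, hY⟩
    exact ⟨_, _, _, _, _, Triangle.shift_distinguished _ hT n, P.le_shift n X hX,
      Q.le_shift n Y hY⟩⟩

instance [P.IsClosedUnderFiniteProducts] [Q.IsClosedUnderFiniteProducts] :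
    (P.extensionProduct Q).IsClosedUnderFiniteProducts where
  isClosedUnderLimitsOfShape J _ := ⟨by
    rintro A ⟨p⟩
    choose X Y f g h hT hX hY using fun j : J => p.prop_diag_obj ⟨j⟩
    let e := (productIsProduct fun j => p.diag.obj ⟨j⟩).conePointUniqueUpToIso
      ((IsLimit.postcomposeHomEquiv Discrete.natIsoFunctor _).2 p.isLimit)
    exact ObjectProperty.prop_of_iso _ e ⟨_, _, _, _, _, productTriangle_distinguished _ hT,
      P.prop_pi X hX, Q.prop_pi Y hY⟩⟩

theorem exists_thickPower_eq_thickOne (P : ObjectProperty T) (n : ℕ) :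
    ∃ Q, thickPower P n = thickOne Q := by
  cases n with
  | zero => exact ⟨⊥, le_antisymm (fun X hX => .zero X hX) fun _ hX => isZero_of_thickOne_bot hX⟩
  | succ n => exact ⟨_, rfl⟩

instance (n : ℕ) : (thickPower P n).IsStableUnderRetracts := by
  obtain ⟨Q, h⟩ := exists_thickPower_eq_thickOne P n
  rw [h]
  infer_instance

instance (n : ℕ) : (thickPower P n).IsStableUnderShift ℤ := by
  obtain ⟨Q, h⟩ := exists_thickPower_eq_thickOne P n
  rw [h]
  infer_instance

instance (n : ℕ) : (thickPower P n).IsClosedUnderFiniteProducts := by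
  obtain ⟨Q, h⟩ := exists_thickPower_eq_thickOne P n
  rw [h]
  infer_instance

theorem thickPower_succ (n : ℕ) :
    thickPower P (n + 1) =
      (ObjectProperty.extensionProduct (thickOne P) (thickPower P n)).retractClosure := by
  rw [thickPower, triangleProduct_eq_extensionProduct]
  refine le_antisymm thickOne_le_retractClosure ?_
  rw [ObjectProperty.retractClosure_le_iff]
  exact fun X hX => .of X hX

theorem thickPower_add [IsTriangulated T] (a b : ℕ) :
    (thickPower P a).extensionProduct (thickPower P b) ≤ thickPower P (a + b) := by
  induction a with
  | zero =>
    rintro A ⟨X, Y, f, g, h, hT, hX, hY⟩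
    have : IsIso g := (Triangle.isZero₁_iff_isIso₂ _ hT).1 hX
    rw [zero_add]
    exact (thickPower P b).prop_of_iso (asIso g).symm hY
  | succ a ih =>
    rw [Nat.add_right_comm, thickPower_succ, thickPower_succ]
    refine (ObjectProperty.monotone_extensionProduct_right _
      (ObjectProperty.le_retractClosure _)).trans
      ((ObjectProperty.extensionProduct_retractClosure_retractClosure_le _ _).trans
      (ObjectProperty.monotone_retractClosure ?_))
    rw [ObjectProperty.extensionProduct_assoc]
    exact ObjectProperty.monotone_extensionProduct_right _ ih

variable {T' : Type u'} [Category.{v'} T'] [HasZeroObject T'] [HasShift T' ℤ] [Preadditive T']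
  [∀ n : ℤ, (shiftFunctor T' n).Additive] [Pretriangulated T'] (F : T ⥤ T') [F.CommShift ℤ]
  [F.IsTriangulated]

theorem thickPower_map {R : ObjectProperty T'}
    (h : P ≤ ObjectProperty.inverseImage (thickOne R) F) {n : ℕ} {X : T}
    (hX : thickPower P n X) : thickPower R n (F.obj X) := by
  induction n generalizing X with
  | zero => exact F.map_isZero hX
  | succ n ih =>
    refine thickOne_map F ?_ hX
    rintro A ⟨X, Y, f, g, k, hX, hY, hT⟩
    exact .of _ ⟨_, _, _, _, _, thickOne_map F h hX, ih hY, F.map_distinguished _ hT⟩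

theorem thickPower_eq_map {G : T} {n : ℕ} {X : T} (hX : thickPower (fun X => X = G) n X) :
    thickPower (fun X => X = F.obj G) n (F.obj X) :=
  thickPower_map F (fun _ h => .of _ (h ▸ rfl)) hX

theorem rouquierDimension_le_of_essSurj [F.EssSurj] :
    rouquierDimension T' ≤ rouquierDimension T := by
  refine iInf_natCast_le_of_imp ?_
  rintro m ⟨G, hG⟩
  exact ⟨F.obj G, fun A => (thickPower _ _).prop_of_iso (F.objObjPreimageIso A)
    (thickPower_eq_map F (hG _))⟩

theorem exists_distTriang_fullSubcategory [P.IsTriangulated] {X A Y : P.FullSubcategory}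
    {f : X.obj ⟶ A.obj} {g : A.obj ⟶ Y.obj} {h : Y.obj ⟶ X.obj⟦(1 : ℤ)⟧}
    (hT : Triangle.mk f g h ∈ distTriang T) :
    ∃ (f' : X ⟶ A) (g' : A ⟶ Y) (h' : Y ⟶ X⟦(1 : ℤ)⟧),
      Triangle.mk f' g' h' ∈ distTriang P.FullSubcategory := by
  let h' : Y ⟶ X⟦(1 : ℤ)⟧ :=
    P.fullyFaithfulι.preimage (h ≫ (P.ι.commShiftIso (1 : ℤ)).inv.app X)
  have hh' : P.ι.map h' ≫ (P.ι.commShiftIso (1 : ℤ)).hom.app X = h := by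
    simp [h']
  refine ⟨P.fullyFaithfulι.preimage f, P.fullyFaithfulι.preimage g, h',
    isomorphic_distinguished _ hT _
      (Triangle.isoMk _ _ (Iso.refl _) (Iso.refl _) (Iso.refl _) ?_ ?_ ?_)⟩
  · exact (Category.comp_id _).trans (Category.id_comp _).symm
  · exact (Category.comp_id _).trans (Category.id_comp _).symm
  · exact (congrArg (_ ≫ ·) ((shiftFunctor T (1 : ℤ)).map_id _)).trans
      ((Category.comp_id _).trans (hh'.trans (Category.id_comp h).symm))

end Pretriangulated

section BoundedDerivedCategory

universe v w' v' u'

open DerivedCategory DerivedCategory.TStructure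

/-- The terms of the complex `K` vanish in all but finitely many degrees. -/
def IsStrictlyBounded {C : Type u} [Category.{v} C] [HasZeroMorphisms C]
    (K : CochainComplex C ℤ) : Prop :=
  ∃ a b : ℤ, K.IsStrictlyGE a ∧ K.IsStrictlyLE b

theorem IsStrictlyBounded.of_isZero_imp {C : Type u} [Category.{v} C] [HasZeroMorphisms C]
    {D : Type u'} [Category.{v'} D] [HasZeroMorphisms D] {K : CochainComplex C ℤ}
    {K' : CochainComplex D ℤ} (hK : IsStrictlyBounded K)
    (h : ∀ i, IsZero (K.X i) → IsZero (K'.X i)) : IsStrictlyBounded K' := by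
  obtain ⟨a, b, ha, hb⟩ := hK
  exact ⟨a, b, (K'.isStrictlyGE_iff a).2 fun i hi => h i (K.isZero_of_isStrictlyGE a i hi),
    (K'.isStrictlyLE_iff b).2 fun i hi => h i (K.isZero_of_isStrictlyLE b i hi)⟩

theorem IsStrictlyBounded.map {C : Type u} [Category.{v} C] [Preadditive C] {D : Type u'}
    [Category.{v'} D] [Preadditive D] (F : C ⥤ D) [F.Additive] {K : CochainComplex C ℤ}
    (hK : IsStrictlyBounded K) :
    IsStrictlyBounded ((F.mapHomologicalComplex (ComplexShape.up ℤ)).obj K) :=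
  hK.of_isZero_imp fun _ h => F.map_isZero h

variable {C : Type u} [Category.{v} C] [Abelian C] [HasDerivedCategory.{w} C]
  {D : Type u'} [Category.{v'} D] [Abelian D] [HasDerivedCategory.{w'} D]

theorem IsStrictlyBounded.bounded_Q_obj {K : CochainComplex C ℤ} (hK : IsStrictlyBounded K) :
    (t : Triangulated.TStructure (DerivedCategory C)).bounded (Q.obj K) := by
  obtain ⟨a, b, ha, hb⟩ := hK
  exact ⟨⟨a, K, Iso.refl _, ha⟩, ⟨b, K, Iso.refl _, hb⟩⟩

/-- A strictly bounded complex, as an object of the bounded derived category. -/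
noncomputable def boundedQ (K : CochainComplex C ℤ) (hK : IsStrictlyBounded K) : Bounded C :=
  ⟨Q.obj K, hK.bounded_Q_obj⟩

theorem exists_iso_boundedQ (X : Bounded C) :
    ∃ (K : CochainComplex C ℤ) (hK : IsStrictlyBounded K), Nonempty (X ≅ boundedQ K hK) := by
  obtain ⟨⟨a, ha⟩, ⟨b, hb⟩⟩ := X.property
  obtain ⟨K, h₁, h₂, ⟨e⟩⟩ := exists_iso_Q_obj_of_isGE_of_isLE X.obj a b
  exact ⟨K, ⟨a, b, h₁, h₂⟩, ⟨ObjectProperty.isoMk _ e⟩⟩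

theorem exists_distTriang_boundedQ {S : ShortComplex (CochainComplex C ℤ)} (hS : S.ShortExact)
    (h₁ : IsStrictlyBounded S.X₁) (h₂ : IsStrictlyBounded S.X₂) (h₃ : IsStrictlyBounded S.X₃) :
    ∃ (f : boundedQ S.X₁ h₁ ⟶ boundedQ S.X₂ h₂) (g : boundedQ S.X₂ h₂ ⟶ boundedQ S.X₃ h₃)
      (h : boundedQ S.X₃ h₃ ⟶ (boundedQ S.X₁ h₁)⟦(1 : ℤ)⟧),
      Triangle.mk f g h ∈ distTriang (Bounded C) :=
  exists_distTriang_fullSubcategory (X := boundedQ S.X₁ h₁) (A := boundedQ S.X₂ h₂)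
    (Y := boundedQ S.X₃ h₃) (triangleOfSES_distinguished hS)

variable (F : C ⥤ D) [F.Additive] [PreservesFiniteLimits F] [PreservesFiniteColimits F]

theorem bounded_mapDerivedCategory (X : Bounded C) :
    (t : Triangulated.TStructure (DerivedCategory D)).bounded
      ((Bounded.ι ⋙ F.mapDerivedCategory).obj X) := by
  obtain ⟨K, hK, ⟨e⟩⟩ := exists_iso_boundedQ X
  exact ObjectProperty.prop_of_iso _ ((Bounded.ι ⋙ F.mapDerivedCategory).mapIso e ≪≫
    F.mapDerivedCategoryFactors.app K).symm (hK.map F).bounded_Q_obj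

/-- The functor between bounded derived categories induced by an exact functor. -/
noncomputable def mapBoundedDerived : Bounded C ⥤ Bounded D :=
  (t : Triangulated.TStructure (DerivedCategory D)).bounded.lift (Bounded.ι ⋙ F.mapDerivedCategory)
    (bounded_mapDerivedCategory F)

noncomputable instance : (mapBoundedDerived F).CommShift ℤ :=
  inferInstanceAs (ObjectProperty.lift _ (Bounded.ι ⋙ F.mapDerivedCategory)
    (bounded_mapDerivedCategory F) |>.CommShift ℤ)

instance : (mapBoundedDerived F).IsTriangulated :=
  inferInstanceAs (ObjectProperty.lift _ (Bounded.ι ⋙ F.mapDerivedCategory)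
    (bounded_mapDerivedCategory F) |>.IsTriangulated)

/-- The functor induced by an exact functor on bounded derived categories is computed termwise. -/
noncomputable def mapBoundedDerivedIso (K : CochainComplex C ℤ) (hK : IsStrictlyBounded K) :
    (mapBoundedDerived F).obj (boundedQ K hK) ≅ boundedQ _ (hK.map F) :=
  ObjectProperty.isoMk _ (F.mapDerivedCategoryFactors.app K)

theorem essSurj_mapBoundedDerived_of_section (Z : D ⥤ C) [Z.Additive] (e : Z ⋙ F ≅ 𝟭 D) :
    (mapBoundedDerived F).EssSurj := by
  refine ⟨fun X => ?_⟩
  obtain ⟨K, hK, ⟨iX⟩⟩ := exists_iso_boundedQ X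
  let i : (F.mapHomologicalComplex (ComplexShape.up ℤ)).obj
      ((Z.mapHomologicalComplex (ComplexShape.up ℤ)).obj K) ≅ K :=
    (NatIso.mapHomologicalComplex e (ComplexShape.up ℤ)).app K ≪≫
      (Functor.mapHomologicalComplexIdIso D (ComplexShape.up ℤ)).app K
  have iQ : boundedQ _ ((hK.map Z).map F) ≅ boundedQ K hK :=
    ObjectProperty.isoMk _ (Q.mapIso i)
  exact ⟨boundedQ _ (hK.map Z), ⟨mapBoundedDerivedIso F _ (hK.map Z) ≪≫ iQ ≪≫ iX.symm⟩⟩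

end BoundedDerivedCategory

section NilpotentLengthOfComplexes

universe v w' v' u'

open DerivedCategory

theorem exists_termwise_epi {A : Type u} [Category.{v} A] [Preadditive A] {B : Type u'}
    [Category.{v'} B] [Abelian B] {L : B ⥤ A} [L.Additive] {Z : A ⥤ B} [Z.Additive]
    (η : 𝟭 B ⟶ L ⋙ Z) [∀ X, Epi (η.app X)] (K : CochainComplex B ℤ) :
    ∃ f : K ⟶ (Z.mapHomologicalComplex (ComplexShape.up ℤ)).obj
        ((L.mapHomologicalComplex (ComplexShape.up ℤ)).obj K),
      Epi f ∧ ∀ i, Nonempty (kernel (η.app (K.X i)) ≅ (kernel f).X i) := by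
  let f : K ⟶ (Z.mapHomologicalComplex (ComplexShape.up ℤ)).obj
      ((L.mapHomologicalComplex (ComplexShape.up ℤ)).obj K) :=
    (Functor.mapHomologicalComplexIdIso B (ComplexShape.up ℤ)).inv.app K ≫
      (NatTrans.mapHomologicalComplex η (ComplexShape.up ℤ)).app K
  have hf (i : ℤ) : η.app (K.X i) = f.f i := (Category.id_comp _).symm
  have hepi (i : ℤ) : Epi (f.f i) := hf i ▸ (inferInstance : ∀ X, Epi (η.app X)) (K.X i)
  exact ⟨f, HomologicalComplex.epi_of_epi_f f hepi, fun i =>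
    ⟨kernelIsoOfEq (hf i) ≪≫
      (PreservesKernel.iso (HomologicalComplex.eval B (ComplexShape.up ℤ) i) f).symm⟩⟩

variable {A : Type u} [Category.{v} A] [Abelian A] [HasDerivedCategory.{w} A]
  {B : Type u'} [Category.{v'} B] [Abelian B] [HasDerivedCategory.{w'} B]
  {L : B ⥤ A} {Z : A ⥤ B} (η : 𝟭 B ⟶ L ⋙ Z) [∀ X, Epi (η.app X)]
  [L.Additive] [Z.Additive] [PreservesFiniteLimits Z] [PreservesFiniteColimits Z]

theorem thickPower_boundedQ_of_hasNilpotentLength {G : Bounded A} {m : ℕ}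
    (hG : ∀ X, thickPower (fun X => X = G) m X) {k : ℕ} (K : CochainComplex B ℤ)
    (hK : IsStrictlyBounded K) (hnil : ∀ i, HasNilpotentLength η k (K.X i)) :
    thickPower (fun X => X = (mapBoundedDerived Z).obj G) (k * m) (boundedQ K hK) := by
  induction k generalizing K with
  | zero =>
    have hzero : IsZero K := (IsZero.iff_id_eq_zero _).2 (by
      ext i
      exact (hnil i : IsZero (K.X i)).eq_of_src _ _)
    rw [zero_mul]
    refine (IsZero.iff_id_eq_zero _).2 ?_
    ext
    exact (Q.map_isZero hzero).eq_of_src _ _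
  | succ k ih =>
    obtain ⟨f, _, hker⟩ := exists_termwise_epi η K
    have hS : (ShortComplex.mk (kernel.ι f) f (kernel.condition f)).ShortExact :=
      shortExact_of_lift _ _ _ fun _ g hg => ⟨kernel.lift f g hg, kernel.lift_ι f g hg⟩
    have hbounded : IsStrictlyBounded (kernel f) :=
      hK.of_isZero_imp fun i hi => hi.of_mono ((kernel.ι f).f i)
    have hnil' (i : ℤ) : HasNilpotentLength η k ((kernel f).X i) :=
      let ⟨e⟩ := hker i
      HasNilpotentLength.of_iso (hnil i) e
    obtain ⟨a, b, c, hT⟩ := exists_distTriang_boundedQ hS hbounded hK ((hK.map L).map Z)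
    rw [add_mul, one_mul]
    exact thickPower_add _ _ _ ⟨_, _, a, b, c, hT, ih _ hbounded hnil',
      (thickPower _ m).prop_of_iso (mapBoundedDerivedIso Z _ (hK.map L))
        (thickPower_eq_map (mapBoundedDerived Z) (hG _))⟩

theorem rouquierDimension_bounded_le_mul {n : ℕ} (hn : 1 ≤ n)
    (hnil : ∀ X, HasNilpotentLength η n X) :
    rouquierDimension (Bounded B) ≤ n * (rouquierDimension (Bounded A) + 1) - 1 := by
  refine iInf_natCast_le_mul hn ?_
  rintro m ⟨G, hG⟩
  refine ⟨(mapBoundedDerived Z).obj G, fun X => ?_⟩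
  rw [Nat.sub_add_cancel (Nat.mul_pos hn m.succ_pos)]
  obtain ⟨K, hK, ⟨e⟩⟩ := exists_iso_boundedQ X
  exact (thickPower _ _).prop_of_iso e.symm
    (thickPower_boundedQ_of_hasNilpotentLength η hG K hK fun _ => hnil _)

end NilpotentLengthOfComplexes

section Progenerators

universe v v' u'

attribute [local instance] Abelian.hasFiniteBiproducts

variable {C : Type u} [Category.{v} C] [Abelian C] {D : Type u'} [Category.{v'} D] [Abelian D]
  {G : C} (hG : IsProgenerator G)

include hG

theorem IsProgenerator.isProjective_le_addObj : CategoryTheory.isProjective C ≤ addObj G := by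
  intro X (_ : Projective X)
  obtain ⟨K, P, hP, i, p, w, h⟩ := hG.exists_shortExactSeq X
  have : Epi p := h.epi_g
  exact (addObj G).prop_of_retract
    ⟨Projective.factorThru (𝟙 X) p, p, Projective.factorThru_comp _ _⟩ hP

theorem IsProgenerator.preservesProjectiveObjects (F : C ⥤ D) [F.Additive]
    (hF : Projective (F.obj G)) : F.PreservesProjectiveObjects where
  projective_obj hX := addObj_le_iff (Q := (CategoryTheory.isProjective D).inverseImage F).2 hF _
    (hG.isProjective_le_addObj _ hX)

theorem IsProgenerator.hasProjectiveDimensionLE_map (F : C ⥤ D) [F.Additive] {n : ℕ}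
    (hF : HasProjectiveDimensionLE (F.obj G) n) {X : C} (hX : Projective X) :
    HasProjectiveDimensionLE (F.obj X) n := by
  let P : ObjectProperty D := fun Y => HasProjectiveDimensionLE Y n
  have : P.IsStableUnderRetracts := ⟨fun r (_ : HasProjectiveDimensionLE _ n) =>
    r.hasProjectiveDimensionLT (n + 1)⟩
  have : IsAddClosed P := .of_isZero_of_biprod
    (fun _ h => have := h.hasProjectiveDimensionLT_zero
      hasProjectiveDimensionLT_of_ge _ 0 _ (Nat.zero_le _))
    fun _ _ (_ : HasProjectiveDimensionLE _ n) (_ : HasProjectiveDimensionLE _ n) =>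
      inferInstanceAs (HasProjectiveDimensionLT (_ ⊞ _) (n + 1))
  exact addObj_le_iff (Q := P.inverseImage F).2 hF _ (hG.isProjective_le_addObj _ hX)

end Progenerators

section FinitelyGeneratedModules

attribute [local instance] Abelian.hasFiniteBiproducts

variable {A B : Type u} [Ring A] [Ring B]

theorem epi_fgModuleCat_of_surjective {X Y : FGModuleCat.{u} A} (f : X ⟶ Y)
    (hf : Function.Surjective f.hom.hom) : Epi f :=
  ConcreteCategory.epi_of_surjective f hf

section Noetherian

variable [IsNoetherianRing A]

theorem surjective_of_epi_fgModuleCat {X Y : FGModuleCat.{u} A} (f : X ⟶ Y) [Epi f] :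
    Function.Surjective f.hom.hom :=
  (ModuleCat.epi_iff_surjective _).1
    (inferInstance : Epi ((forget₂ (FGModuleCat.{u} A) (ModuleCat.{u} A)).map f))

theorem injective_of_mono_fgModuleCat {X Y : FGModuleCat.{u} A} (f : X ⟶ Y) [Mono f] :
    Function.Injective f.hom.hom :=
  (ModuleCat.mono_iff_injective _).1
    (inferInstance : Mono ((forget₂ (FGModuleCat.{u} A) (ModuleCat.{u} A)).map f))

theorem projective_fgModuleCat (X : FGModuleCat.{u} A) [Module.Projective A X] :
    Projective X where
  factors f e _ := by
    obtain ⟨h, hh⟩ := Module.projective_lifting_property e.hom.hom f.hom.hom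
      (surjective_of_epi_fgModuleCat e)
    exact ⟨FGModuleCat.ofHom h, by ext x; exact congr($hh x)⟩

variable (A) in
theorem addObj_fgModuleCat_pi (k : ℕ) :
    addObj (FGModuleCat.of.{u} A A) (FGModuleCat.of A (Fin k → A)) := by
  let f : Fin k → FGModuleCat.{u} A := fun _ => FGModuleCat.of A A
  refine (addObj _).prop_of_retract
    ⟨biproduct.lift fun j => FGModuleCat.ofHom (LinearMap.proj j),
      biproduct.desc fun j => FGModuleCat.ofHom (LinearMap.single A (fun _ => A) j), ?_⟩
    (IsAddClosed.biproduct f fun _ => addObj_self _)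
  rw [biproduct.lift_desc]
  refine (ModuleCat.isFG A).ι.map_injective ?_
  rw [Functor.map_sum]
  ext x : 2
  simp only [ObjectProperty.ι_map, ObjectProperty.FullSubcategory.comp_hom, ModuleCat.hom_sum,
    ModuleCat.hom_comp, LinearMap.coe_sum, Finset.sum_apply]
  exact Finset.univ_sum_single x

variable (A) in
theorem isProgenerator_fgModuleCat : IsProgenerator (FGModuleCat.of.{u} A A) where
  projective := projective_fgModuleCat _
  exists_shortExactSeq X := by
    obtain ⟨k, f, hf⟩ := Module.Finite.exists_fin' A X
    let p : FGModuleCat.of.{u} A (Fin k → A) ⟶ X := FGModuleCat.ofHom f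
    have : Epi p := epi_fgModuleCat_of_surjective p hf
    exact ⟨_, _, addObj_fgModuleCat_pi A k, shortExactSeq_kernel p⟩

end Noetherian

/-- `B` is a finitely generated module along the ring homomorphism `f : A →+* B`. This is
`RingHom.Finite` for noncommutative rings. -/
abbrev IsFiniteAlong (f : A →+* B) : Prop :=
  Module.Finite A ((ModuleCat.restrictScalars.{u} f).obj (ModuleCat.of B B))

theorem IsFiniteAlong.finite_restrictScalars {f : A →+* B} (hf : IsFiniteAlong f)
    (X : ModuleCat.{u} B) [Module.Finite B X] :
    Module.Finite A ((ModuleCat.restrictScalars.{u} f).obj X) := by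
  let : Module A B := Module.compHom B f
  let : Module A X := Module.compHom X f
  have : IsScalarTower A B X := ⟨fun a b x => mul_smul (f a) b x⟩
  have : Module.Finite A B := hf
  exact (Module.Finite.trans B X : Module.Finite A X)

theorem IsFiniteAlong.of_surjective {f : A →+* B} (hf : Function.Surjective f) :
    IsFiniteAlong f := by
  let : Module A B := Module.compHom B f
  exact Module.Finite.of_surjective (LinearMap.toSpanSingleton A B 1) fun b =>
    let ⟨a, ha⟩ := hf b
    ⟨a, (mul_one (f a)).trans ha⟩

theorem IsFiniteAlong.isNoetherianRing [IsNoetherianRing A] {f : A →+* B}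
    (hf : IsFiniteAlong f) : IsNoetherianRing B := by
  let : Module A B := Module.compHom B f
  have : IsScalarTower A B B := ⟨fun a b c => mul_assoc (f a) b c⟩
  have : Module.Finite A B := hf
  exact isNoetherian_of_tower A inferInstance

/-- Restriction of scalars between categories of finitely generated modules. -/
noncomputable def fgRestrict (f : A →+* B) (hf : IsFiniteAlong f) :
    FGModuleCat.{u} B ⥤ FGModuleCat.{u} A :=
  (ModuleCat.isFG.{u} A).lift
    (forget₂ (FGModuleCat.{u} B) (ModuleCat.{u} B) ⋙ ModuleCat.restrictScalars.{u} f) fun X =>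
      hf.finite_restrictScalars X.obj

section Restriction

variable (f : A →+* B) (hf : IsFiniteAlong f)

/-- Restriction of scalars of finitely generated modules agrees with that of all modules. -/
noncomputable def fgRestrictCompForget :
    fgRestrict f hf ⋙ forget₂ (FGModuleCat.{u} A) (ModuleCat.{u} A) ≅
      forget₂ (FGModuleCat.{u} B) (ModuleCat.{u} B) ⋙ ModuleCat.restrictScalars.{u} f :=
  Iso.refl _

instance : (fgRestrict f hf).Additive where
  map_add := rfl

variable [IsNoetherianRing A] [IsNoetherianRing B]

instance : PreservesFiniteLimits (fgRestrict f hf) :=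
  have : PreservesFiniteLimits (ModuleCat.restrictScalars.{u} f) :=
    ⟨fun _ _ _ => ⟨inferInstance⟩⟩
  have : PreservesFiniteLimits
      (fgRestrict f hf ⋙ forget₂ (FGModuleCat.{u} A) (ModuleCat.{u} A)) :=
    preservesFiniteLimits_of_natIso (fgRestrictCompForget f hf).symm
  preservesFiniteLimits_of_reflects_of_preserves _
    (forget₂ (FGModuleCat.{u} A) (ModuleCat.{u} A))

instance : PreservesFiniteColimits (fgRestrict f hf) :=
  have : PreservesFiniteColimits
      (fgRestrict f hf ⋙ forget₂ (FGModuleCat.{u} A) (ModuleCat.{u} A)) :=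
    preservesFiniteColimits_of_natIso (fgRestrictCompForget f hf).symm
  preservesFiniteColimits_of_reflects_of_preserves _
    (forget₂ (FGModuleCat.{u} A) (ModuleCat.{u} A))

theorem preservesProjectiveObjects_fgRestrict
    (h : Module.Projective A ((ModuleCat.restrictScalars.{u} f).obj (ModuleCat.of B B))) :
    (fgRestrict f hf).PreservesProjectiveObjects :=
  have : Module.Projective A ((fgRestrict f hf).obj (FGModuleCat.of.{u} B B)) := h
  (isProgenerator_fgModuleCat B).preservesProjectiveObjects _ (projective_fgModuleCat _)

end Restriction

end FinitelyGeneratedModules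

section QuotientByIdeal

variable {B : Type u} [Ring B] (I : Ideal B)

/-- The functor `X ↦ X / I X`. -/
noncomputable def fgQuotient : FGModuleCat.{u} B ⥤ FGModuleCat.{u} B where
  obj X := FGModuleCat.of B (X ⧸ I • (⊤ : Submodule B X))
  map {X Y} f := FGModuleCat.ofHom (Submodule.mapQ _ _ f.hom.hom (by
    rw [← Submodule.map_le_iff_le_comap, Submodule.map_smul'']
    exact Submodule.smul_mono le_rfl le_top))
  map_id X := by
    ext x
    rfl
  map_comp f g := by
    ext x
    rfl

instance : (fgQuotient I).Additive where
  map_add {X Y f g} := by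
    ext x
    obtain ⟨x, rfl⟩ := Submodule.Quotient.mk_surjective _ x
    rfl

end QuotientByIdeal

section SplitExtension

attribute [local instance] Abelian.hasFiniteBiproducts

variable {A B : Type u} [Ring A] [Ring B] {ι : A →+* B} {π : B →+* A}
  (hπι : π.comp ι = RingHom.id A) (hι : IsFiniteAlong ι) (hπ : IsFiniteAlong π)

include hπι in
theorem ringHom_surjective_of_comp_eq_id : Function.Surjective π :=
  Function.RightInverse.surjective (g := ι) (DFunLike.congr_fun hπι)

/-- Restriction along a section of `π` is a retraction of restriction along `π`. -/
noncomputable def fgRestrictCompIso : fgRestrict π hπ ⋙ fgRestrict ι hι ≅ 𝟭 (FGModuleCat.{u} A) :=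
  NatIso.ofComponents (fun X => (ModuleCat.isFG.{u} A).isoMk
    ((ModuleCat.restrictScalarsComp'App ι π _ hπι.symm X.obj).symm ≪≫
      ModuleCat.restrictScalarsId'App _ rfl X.obj)) (fun _ => rfl)

include hπι in
theorem essSurj_fgRestrict_of_comp_eq_id : (fgRestrict ι hι).EssSurj :=
  have hπ : IsFiniteAlong π := .of_surjective (ringHom_surjective_of_comp_eq_id hπι)
  ⟨fun X => ⟨_, ⟨(fgRestrictCompIso hπι hι hπ).app X⟩⟩⟩

/-- The projection from a module onto its reduction modulo the kernel of `π`, regarded as an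
`A`-module through `ι` and then as a `B`-module through `π`. -/
noncomputable def reductionHom :
    𝟭 (FGModuleCat.{u} B) ⟶
      (fgQuotient (RingHom.ker π) ⋙ fgRestrict ι hι) ⋙ fgRestrict π hπ where
  app X := ObjectProperty.homMk (ModuleCat.ofHom
    (Y := (ModuleCat.restrictScalars.{u} π).obj ((ModuleCat.restrictScalars.{u} ι).obj
      (ModuleCat.of B (X ⧸ RingHom.ker π • (⊤ : Submodule B X)))))
    { toFun := fun x => Submodule.Quotient.mk x
      map_add' := fun _ _ => rfl
      map_smul' := fun b x => by
        refine (Submodule.Quotient.eq _).2 ?_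
        rw [← sub_smul]
        refine Submodule.smul_mem_smul ?_ trivial
        rw [RingHom.mem_ker, map_sub, sub_eq_zero]
        exact congr($hπι (π b)).symm })
  naturality X Y f := rfl

instance (X : FGModuleCat.{u} B) : Epi ((reductionHom hπι hι hπ).app X) :=
  epi_fgModuleCat_of_surjective _ (Submodule.Quotient.mk_surjective _)

theorem hasNilpotentLength_reductionHom [IsNoetherianRing B] {k : ℕ} {X : FGModuleCat.{u} B}
    (hX : RingHom.ker π ^ k • (⊤ : Submodule B X) = ⊥) :
    HasNilpotentLength (reductionHom hπι hι hπ) k X := by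
  induction k generalizing X with
  | zero =>
    rw [Submodule.pow_zero, Ideal.one_eq_top, Submodule.top_smul] at hX
    refine (IsZero.iff_id_eq_zero _).2 ?_
    ext x
    exact (Submodule.mem_bot B).1 (hX ▸ Submodule.mem_top (x := x))
  | succ k ih =>
    let η := (reductionHom hπι hι hπ).app X
    let j := kernel.ι η
    have hj (y) : j.hom.hom y ∈ RingHom.ker π • (⊤ : Submodule B X) :=
      (Submodule.Quotient.mk_eq_zero _).1 congr($(kernel.condition η).hom.hom y)
    refine ih (Submodule.map_injective_of_injective (injective_of_mono_fgModuleCat j) ?_)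
    rw [Submodule.map_bot, Submodule.map_smul'', eq_bot_iff, ← hX, Submodule.pow_succ,
      Submodule.mul_smul]
    refine Submodule.smul_mono le_rfl ?_
    rintro _ ⟨y, -, rfl⟩
    exact hj y

theorem hasNilpotentLength_of_ker_pow_eq_bot [IsNoetherianRing B] {n : ℕ}
    (hker : RingHom.ker π ^ n = ⊥) (X : FGModuleCat.{u} B) :
    HasNilpotentLength (reductionHom hπι hι hπ) n X :=
  hasNilpotentLength_reductionHom hπι hι hπ (by rw [hker, Submodule.bot_smul])

variable [IsNoetherianRing A] [IsNoetherianRing B]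

theorem hasProjectiveDimensionLE_one_fgRestrict (hsurj : Function.Surjective π)
    (hker : Module.Projective B (RingHom.ker π)) {Q : FGModuleCat.{u} A} (hQ : Projective Q) :
    HasProjectiveDimensionLE ((fgRestrict π hπ).obj Q) 1 := by
  refine (isProgenerator_fgModuleCat A).hasProjectiveDimensionLE_map _ ?_ hQ
  have : Projective (FGModuleCat.of.{u} B B) := projective_fgModuleCat _
  have hprojective : Projective (FGModuleCat.of.{u} B (RingHom.ker π)) := projective_fgModuleCat _
  let i : FGModuleCat.of.{u} B (RingHom.ker π) ⟶ FGModuleCat.of.{u} B B :=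
    FGModuleCat.ofHom (Submodule.subtype _)
  let p : FGModuleCat.of.{u} B B ⟶ (fgRestrict π hπ).obj (FGModuleCat.of.{u} A A) :=
    ObjectProperty.homMk (ModuleCat.ofHom
      (Y := (ModuleCat.restrictScalars.{u} π).obj (ModuleCat.of A A))
      { toFun := fun b => π b
        map_add' := fun _ _ => map_add π _ _
        map_smul' := fun _ _ => map_mul π _ _ })
  have : Mono i := ConcreteCategory.mono_of_injective _ Subtype.val_injective
  have : Epi p := epi_fgModuleCat_of_surjective p hsurj
  have hip : i ≫ p = 0 := by
    ext x
    exact x.2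
  have hS : (ShortComplex.mk i p hip).ShortExact := shortExact_of_lift _ _ _ fun W g hg =>
    ⟨FGModuleCat.ofHom (LinearMap.codRestrict _ g.hom.hom fun w => congr($(hg).hom.hom w)), rfl⟩
  exact (hS.hasProjectiveDimensionLT_X₃_iff 0 ‹_›).2
    (projective_iff_hasProjectiveDimensionLT_one.1 hprojective)

variable {n : ℕ} (hn : 1 ≤ n) (hnil : RingHom.ker π ^ n = ⊥)

include hπι hι hn hnil

theorem igusaTodorovDistance_of_split_extension
    (hproj : Module.Projective A ((ModuleCat.restrictScalars.{u} ι).obj (ModuleCat.of B B)))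
    (hker : Module.Projective B (RingHom.ker π)) :
    igusaTodorovDistance (FGModuleCat.{u} A) ≤ igusaTodorovDistance (FGModuleCat.{u} B) ∧
      igusaTodorovDistance (FGModuleCat.{u} B) ≤
        n * (igusaTodorovDistance (FGModuleCat.{u} A) + 1) - 1 := by
  have hsurj := ringHom_surjective_of_comp_eq_id hπι
  have hπ : IsFiniteAlong π := .of_surjective hsurj
  have := essSurj_fgRestrict_of_comp_eq_id hπι hι
  have := preservesProjectiveObjects_fgRestrict ι hι hproj
  exact ⟨igusaTodorovDistance_le_of_essSurj (fgRestrict ι hι),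
    igusaTodorovDistance_le_mul (reductionHom hπι hι hπ) (isProgenerator_fgModuleCat B)
      (fun _ => hasProjectiveDimensionLE_one_fgRestrict hπ hsurj hker) hn
      (hasNilpotentLength_of_ker_pow_eq_bot hπι hι hπ hnil)⟩

theorem extensionDimension_of_split_extension :
    extensionDimension (FGModuleCat.{u} A) ≤ extensionDimension (FGModuleCat.{u} B) ∧
      extensionDimension (FGModuleCat.{u} B) ≤
        n * (extensionDimension (FGModuleCat.{u} A) + 1) - 1 := by
  have hπ : IsFiniteAlong π := .of_surjective (ringHom_surjective_of_comp_eq_id hπι)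
  have := essSurj_fgRestrict_of_comp_eq_id hπι hι
  exact ⟨extensionDimension_le_of_essSurj (fgRestrict ι hι),
    extensionDimension_le_mul (reductionHom hπι hι hπ) hn
      (hasNilpotentLength_of_ker_pow_eq_bot hπι hι hπ hnil)⟩

theorem rouquierDimension_of_split_extension [HasDerivedCategory.{w} (FGModuleCat.{u} A)]
    [HasDerivedCategory.{w} (FGModuleCat.{u} B)] :
    rouquierDimension (DerivedCategory.Bounded (FGModuleCat.{u} A)) ≤
        rouquierDimension (DerivedCategory.Bounded (FGModuleCat.{u} B)) ∧
      rouquierDimension (DerivedCategory.Bounded (FGModuleCat.{u} B)) ≤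
        n * (rouquierDimension (DerivedCategory.Bounded (FGModuleCat.{u} A)) + 1) - 1 := by
  have hπ : IsFiniteAlong π := .of_surjective (ringHom_surjective_of_comp_eq_id hπι)
  have := essSurj_mapBoundedDerived_of_section (fgRestrict ι hι) _ (fgRestrictCompIso hπι hι hπ)
  exact ⟨rouquierDimension_le_of_essSurj (mapBoundedDerived (fgRestrict ι hι)),
    rouquierDimension_bounded_le_mul (reductionHom hπι hι hπ) hn
      (hasNilpotentLength_of_ker_pow_eq_bot hπι hι hπ hnil)⟩

end SplitExtension

namespace BalancedTensor

variable {A : Type u} [Ring A] {X Y Z : Type u} [AddCommGroup X] [AddCommGroup Y]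
  [AddCommGroup Z] [Module Aᵐᵒᵖ X] [Module A Y]

theorem tmul_smul (x : X) (a : A) (y : Y) :
    tmul A (MulOpposite.op a • x) y = tmul A x (a • y) :=
  (QuotientAddGroup.eq_iff_sub_mem (N := balancedRelations A X Y)).2
    (AddSubgroup.subset_closure ⟨x, a, y, rfl⟩)

/-- The homomorphism from `X ⊗_A Y` induced by a balanced biadditive map. -/
noncomputable def lift (f : X →+ Y →+ Z)
    (hf : ∀ (x : X) (a : A) (y : Y), f (MulOpposite.op a • x) y = f x (a • y)) :
    BalancedTensor A X Y →+ Z :=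
  QuotientAddGroup.lift (balancedRelations A X Y)
    (TensorProduct.liftAddHom f fun r x y => by
      rw [map_zsmul, map_zsmul, AddMonoidHom.coe_smul, Pi.smul_apply]) (by
      refine (AddSubgroup.closure_le _).2 ?_
      rintro _ ⟨x, a, y, rfl⟩
      simp [hf])

variable {S : Type u} [Ring S] [Module S Y]

variable (A X S Y) in
/-- The action of a ring through the second factor of `X ⊗_A Y`. -/
noncomputable def actionRight [SMulCommClass A S Y] : S →+* AddMonoid.End (BalancedTensor A X Y) :=
  haveI : SMulCommClass S A Y := .symm _ _ _
  { toFun s := map LinearMap.id (DistribSMul.toLinearMap A Y s)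
    map_one' := hom_ext fun x y => congrArg (tmul A x) (one_smul S y)
    map_mul' s s' := hom_ext fun x y => congrArg (tmul A x) (mul_smul s s' y)
    map_zero' := hom_ext fun x y => (congrArg (tmul A x) (zero_smul S y)).trans (tmul_zero x)
    map_add' s s' := hom_ext fun x y =>
      (congrArg (tmul A x) (add_smul s s' y)).trans (tmul_add x _ _) }

variable [Module S (BalancedTensor A X Y)]

/-- The map `y ↦ x ⊗ y`, linear over any ring acting through the second factor. -/
noncomputable def tmulLinear
    (hS : ∀ (s : S) (x : X) (y : Y), s • tmul A x y = tmul A x (s • y)) (x : X) :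
    Y →ₗ[S] BalancedTensor A X Y where
  toFun := tmul A x
  map_add' := tmul_add x
  map_smul' s y := (hS s x y).symm

/-- The linear map from `X ⊗_A Y` induced by a balanced map which is linear in the second
variable over a ring acting through the second factor. -/
noncomputable def liftLinear [Module S Z]
    (hS : ∀ (s : S) (x : X) (y : Y), s • tmul A x y = tmul A x (s • y)) (f : X →+ Y →ₗ[S] Z)
    (hf : ∀ (x : X) (a : A) (y : Y), f (MulOpposite.op a • x) y = f x (a • y)) :
    BalancedTensor A X Y →ₗ[S] Z :=
  { lift (AddMonoidHom.mk' (fun x => (f x).toAddMonoidHom) fun x y => by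
      ext
      simp) hf with
    map_smul' := fun s t => by
      induction t using induction_on with
      | zero => simp
      | tmul x y => exact (congrArg _ (hS s x y)).trans ((f x).map_smul s y)
      | add t t' ht ht' =>
        rw [smul_add]
        simp_all }

theorem finite (hS : ∀ (s : S) (x : X) (y : Y), s • tmul A x y = tmul A x (s • y))
    [Module.Finite Aᵐᵒᵖ X] [Module.Finite S Y] : Module.Finite S (BalancedTensor A X Y) := by
  obtain ⟨g, hg⟩ := Module.Finite.fg_top (R := Aᵐᵒᵖ) (M := X)
  let N : Submodule S (BalancedTensor A X Y) := ⨆ x ∈ g, (tmulLinear hS x).range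
  have tmul_mem (x : X) (y : Y) : tmul A x y ∈ N := by
    have hx : x ∈ Submodule.span Aᵐᵒᵖ (g : Set X) := hg ▸ trivial
    induction hx using Submodule.span_induction generalizing y with
    | mem x hx =>
      exact Submodule.mem_iSup_of_mem x (Submodule.mem_iSup_of_mem hx ⟨y, rfl⟩)
    | zero =>
      rw [zero_tmul]
      exact N.zero_mem
    | add x x' _ _ hx hx' =>
      rw [add_tmul]
      exact N.add_mem (hx y) (hx' y)
    | smul a x _ hx =>
      rw [← MulOpposite.op_unop a, tmul_smul]
      exact hx _
  have hN : N = ⊤ := by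
    refine eq_top_iff.2 fun t _ => ?_
    induction t using induction_on with
    | zero => exact N.zero_mem
    | tmul x y => exact tmul_mem x y
    | add t t' ht ht' => exact N.add_mem (ht trivial) (ht' trivial)
  exact ⟨hN ▸ Submodule.fg_biSup g _ fun x _ => Module.Finite.iff_fg.1 inferInstance⟩

theorem projective (hS : ∀ (s : S) (x : X) (y : Y), s • tmul A x y = tmul A x (s • y))
    [SMulCommClass A S Y] [Module.Projective Aᵐᵒᵖ X] [Module.Projective S Y] :
    Module.Projective S (BalancedTensor A X Y) := by
  classical
  obtain ⟨coord, hcoord⟩ := Module.projective_def'.1 ‹Module.Projective Aᵐᵒᵖ X›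
  have : Module.Projective S (X →₀ Y) := .of_equiv (finsuppLequivDFinsupp S).symm
  let coordTmul (x : X) : Y →ₗ[S] (X →₀ Y) :=
    { toFun y := (coord x).mapRange (fun a => a.unop • y) (zero_smul A y)
      map_add' y y' := by
        ext
        simp
      map_smul' s y := by
        ext
        simp [smul_comm] }
  let split : BalancedTensor A X Y →ₗ[S] (X →₀ Y) := liftLinear hS
    (AddMonoidHom.mk' coordTmul fun x x' => by
      ext y
      simp [coordTmul, add_smul]) fun x a y => by
        ext
        simp [coordTmul, mul_smul]
  refine .of_split split (Finsupp.lsum ℕ (tmulLinear hS))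
    (LinearMap.toAddMonoidHom_injective (hom_ext fun x y => ?_))
  let tmulRight : X →+ BalancedTensor A X Y :=
    AddMonoidHom.mk' (fun x => tmul A x y) fun x x' => add_tmul x x' y
  calc Finsupp.lsum ℕ (tmulLinear hS) (coordTmul x y)
    _ = (coord x).sum fun x' a => tmul A x' (a.unop • y) :=
      Finsupp.sum_mapRange_index (hf := zero_smul A y) fun x' => tmul_zero x'
    _ = (coord x).sum fun x' a => tmulRight (a • x') :=
      Finsupp.sum_congr fun x' _ => (tmul_smul x' _ y).symm
    _ = tmulRight (Finsupp.linearCombination Aᵐᵒᵖ id (coord x)) :=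
      (map_finsuppSum tmulRight _ _).symm
    _ = tmul A x y := congrArg tmulRight congr($hcoord x)

end BalancedTensor

namespace BimodulePower

variable {A M : Type u} [Ring A] [AddCommGroup M] [Module A M] [Module Aᵐᵒᵖ M]
  [SMulCommClass A Aᵐᵒᵖ M]

/-- The product `M^{⊗i} × M → M^{⊗(i+1)}`; it is `BalancedTensor.tmul`, but with the type of the
tensor power visible to instance search. -/
noncomputable def tmul (i : ℕ) : BimodulePower A M i →+ M →ₗ[Aᵐᵒᵖ] BimodulePower A M (i + 1) :=
  AddMonoidHom.mk' (BalancedTensor.tmulLinear fun _ _ _ => rfl) fun x x' =>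
    LinearMap.ext (BalancedTensor.add_tmul x x')

theorem tmul_smul (i : ℕ) (x : BimodulePower A M i) (a : A) (m : M) :
    tmul i (MulOpposite.op a • x) m = tmul i x (a • m) :=
  BalancedTensor.tmul_smul x a m

theorem induction_on {i : ℕ} {p : BimodulePower A M (i + 1) → Prop}
    (t : BimodulePower A M (i + 1)) (zero : p 0) (tmul : ∀ x m, p (tmul i x m))
    (add : ∀ s t, p s → p t → p (s + t)) : p t :=
  BalancedTensor.induction_on (A := A) t zero tmul add

/-- The linear map from a tensor power induced by a balanced map which is linear in the last
factor. -/
noncomputable def lift {i : ℕ} {Z : Type u} [AddCommGroup Z] [Module Aᵐᵒᵖ Z]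
    (f : BimodulePower A M i →+ M →ₗ[Aᵐᵒᵖ] Z)
    (hf : ∀ (x : BimodulePower A M i) (a : A) (m : M),
      f (MulOpposite.op a • x) m = f x (a • m)) : BimodulePower A M (i + 1) →ₗ[Aᵐᵒᵖ] Z :=
  BalancedTensor.liftLinear (fun _ _ _ => rfl) f hf

theorem subsingleton_of_le {n i : ℕ} (hn : Subsingleton (BimodulePower A M n)) (hi : n ≤ i) :
    Subsingleton (BimodulePower A M i) := by
  induction i, hi using Nat.le_induction with
  | base => exact hn
  | succ i _ ih =>
    refine subsingleton_of_forall_eq 0 fun t => ?_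
    induction t using induction_on with
    | zero => rfl
    | tmul x m => rw [Subsingleton.elim x 0, map_zero, LinearMap.zero_apply]
    | add s t hs ht => rw [hs, ht, add_zero]

instance finite [Module.Finite Aᵐᵒᵖ M] (i : ℕ) : Module.Finite Aᵐᵒᵖ (BimodulePower A M i) := by
  induction i with
  | zero => exact .equiv (MulOpposite.opLinearEquiv (M := A) Aᵐᵒᵖ).symm
  | succ i ih => exact BalancedTensor.finite fun _ _ _ => rfl

instance projective [Module.Projective Aᵐᵒᵖ M] (i : ℕ) :
    Module.Projective Aᵐᵒᵖ (BimodulePower A M i) := by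
  induction i with
  | zero => exact .of_equiv (MulOpposite.opLinearEquiv (M := A) Aᵐᵒᵖ).symm
  | succ i ih => exact BalancedTensor.projective fun _ _ _ => rfl

end BimodulePower

namespace TensorRing

section UniversalProperty

variable (A M : Type u) [Ring A] [AddCommGroup M] [Module A M] [Module Aᵐᵒᵖ M]

/-- The inclusion of the base ring. -/
noncomputable def ofRing : A →+* TensorRing A M :=
  letI q := RingQuot.mkRingHom (TensorRingRel A M)
  { toFun := fun a => q (FreeAlgebra.ι ℤ (Sum.inl a))
    map_one' := (RingQuot.mkRingHom_rel .one).trans (map_one q)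
    map_mul' := fun a b => (RingQuot.mkRingHom_rel (.mul a b)).trans (map_mul q _ _)
    map_zero' := by
      have h := (RingQuot.mkRingHom_rel (.add (M := M) (0 : A) 0)).trans (map_add q _ _)
      rw [add_zero] at h
      exact left_eq_add.1 h
    map_add' := fun a b => (RingQuot.mkRingHom_rel (.add a b)).trans (map_add q _ _) }

/-- The inclusion of the bimodule. -/
noncomputable def ofBimodule : M →+ TensorRing A M :=
  letI q := RingQuot.mkRingHom (TensorRingRel A M)
  AddMonoidHom.mk' (fun m => q (FreeAlgebra.ι ℤ (Sum.inr m))) fun x y =>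
    (RingQuot.mkRingHom_rel (.add_right x y)).trans (map_add q _ _)

variable {A M}

theorem ofBimodule_smul (a : A) (m : M) :
    ofBimodule A M (a • m) = ofRing A M a * ofBimodule A M m :=
  (RingQuot.mkRingHom_rel (.left_smul a m)).trans (map_mul _ _ _)

theorem ofBimodule_op_smul (a : A) (m : M) :
    ofBimodule A M (MulOpposite.op a • m) = ofBimodule A M m * ofRing A M a :=
  (RingQuot.mkRingHom_rel (.right_smul a m)).trans (map_mul _ _ _)

theorem induction_on {p : TensorRing A M → Prop} (t : TensorRing A M)
    (ofRing : ∀ a, p (ofRing A M a)) (ofBimodule : ∀ m, p (ofBimodule A M m))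
    (add : ∀ s t, p s → p t → p (s + t)) (mul : ∀ s t, p s → p t → p (s * t)) : p t := by
  obtain ⟨t, rfl⟩ := RingQuot.mkRingHom_surjective (TensorRingRel A M) t
  induction t with
  | grade0 r =>
    have h : RingQuot.mkRingHom (TensorRingRel A M) (algebraMap ℤ _ r) =
        TensorRing.ofRing A M (r : A) :=
      (congrArg _ (eq_intCast _ r)).trans ((map_intCast _ r).trans
        (map_intCast (TensorRing.ofRing A M) r).symm)
    exact h ▸ ofRing _
  | grade1 x => exact x.rec ofRing ofBimodule
  | mul s t hs ht => exact (map_mul (RingQuot.mkRingHom (TensorRingRel A M)) s t) ▸ mul _ _ hs ht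
  | add s t hs ht => exact (map_add (RingQuot.mkRingHom (TensorRingRel A M)) s t) ▸ add _ _ hs ht

variable {S : Type*} [Ring S] (f : A →+* S) (g : M →+ S)
  (hl : ∀ a m, g (a • m) = f a * g m)
  (hr : ∀ (a : A) m, g (MulOpposite.op a • m) = g m * f a)

/-- The universal property of the tensor ring. -/
noncomputable def lift : TensorRing A M →+* S :=
  RingQuot.lift ⟨(FreeAlgebra.lift ℤ (Sum.elim f g)).toRingHom, by
    rintro _ _ (_ | _ | _ | _ | _ | _) <;> simp [hl, hr]⟩

@[simp] theorem lift_ofRing (a : A) : lift f g hl hr (ofRing A M a) = f a :=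
  (RingQuot.lift_mkRingHom_apply _ _ _).trans (by simp)

@[simp] theorem lift_ofBimodule (m : M) : lift f g hl hr (ofBimodule A M m) = g m :=
  (RingQuot.lift_mkRingHom_apply _ _ _).trans (by simp)

variable (A M) in
/-- The projection onto the base ring. -/
noncomputable def toRing : TensorRing A M →+* A :=
  lift (RingHom.id A) 0 (by simp) (by simp)

@[simp] theorem toRing_ofRing (a : A) : toRing A M (ofRing A M a) = a := lift_ofRing _ _ _ _ _

@[simp] theorem toRing_ofBimodule (m : M) : toRing A M (ofBimodule A M m) = 0 :=
  lift_ofBimodule _ _ _ _ _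

noncomputable instance : Module A (TensorRing A M) := Module.compHom _ (ofRing A M)

noncomputable instance : Module Aᵐᵒᵖ (TensorRing A M) := Module.compHom _ (ofRing A M).op

instance : SMulCommClass A (TensorRing A M)ᵐᵒᵖ (TensorRing A M) where
  smul_comm a s t := (mul_assoc (ofRing A M a) t s.unop).symm

theorem smul_eq_ofRing_mul (a : A) (t : TensorRing A M) : a • t = ofRing A M a * t := rfl

theorem op_smul_eq_mul_ofRing (a : Aᵐᵒᵖ) (t : TensorRing A M) :
    a • t = t * ofRing A M a.unop := rfl

end UniversalProperty

section Grading

open DirectSum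

variable (A M : Type u) [Ring A] [AddCommGroup M] [Module A M] [Module Aᵐᵒᵖ M]
  [SMulCommClass A Aᵐᵒᵖ M]

/-- The multiplication `T × M → T`, as a map to right `A`-module homomorphisms. -/
noncomputable def mulBimodule : TensorRing A M →+ M →ₗ[Aᵐᵒᵖ] TensorRing A M :=
  AddMonoidHom.mk' (fun t =>
    { toFun m := t * ofBimodule A M m
      map_add' m m' := by rw [map_add, mul_add]
      map_smul' a m := by
        rw [← MulOpposite.op_unop a, ofBimodule_op_smul, ← mul_assoc]
        rfl })
    fun t t' => LinearMap.ext fun m => add_mul t t' (ofBimodule A M m)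

/-- The multiplication map from a tensor power to the tensor ring. -/
noncomputable def ofPower : ∀ i, BimodulePower A M i →ₗ[Aᵐᵒᵖ] TensorRing A M
  | 0 =>
    { toFun := ofRing A M
      map_add' := map_add (ofRing A M)
      map_smul' := fun a (x : A) => map_mul (ofRing A M) x a.unop }
  | i + 1 => BimodulePower.lift ((mulBimodule A M).comp (ofPower i).toAddMonoidHom) fun x a m => by
      simp [mulBimodule, ofBimodule_smul, op_smul_eq_mul_ofRing, mul_assoc]

variable {A M}

@[simp] theorem ofPower_tmul (i : ℕ) (x : BimodulePower A M i) (m : M) :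
    ofPower A M (i + 1) (BimodulePower.tmul i x m) = ofPower A M i x * ofBimodule A M m := rfl

variable (A M) in
/-- The direct sum `A ⊕ M ⊕ (M ⊗ M) ⊕ ⋯` of the tensor powers. -/
abbrev Graded : Type u := ⨁ i, BimodulePower A M i

theorem op_smul_of (a : Aᵐᵒᵖ) (i : ℕ) (x : BimodulePower A M i) :
    a • of (BimodulePower A M) i x = of _ i (a • x) := (DirectSum.of_smul Aᵐᵒᵖ i a x).symm

variable (A M) in
/-- The multiplication map from the direct sum of the tensor powers to the tensor ring. -/
noncomputable def ofGraded : Graded A M →ₗ[Aᵐᵒᵖ] TensorRing A M :=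
  DirectSum.toModule Aᵐᵒᵖ ℕ _ (ofPower A M)

@[simp] theorem ofGraded_of (i : ℕ) (x : BimodulePower A M i) :
    ofGraded A M (of _ i x) = ofPower A M i x := DirectSum.toModule_lof _ i x

variable (A) in
/-- Right multiplication by an element of the bimodule. -/
noncomputable def shiftRight (m : M) : Graded A M →+ Graded A M :=
  DirectSum.toAddMonoid fun i =>
    (of _ (i + 1)).comp (AddMonoidHom.mk' (fun x => BimodulePower.tmul i x m) fun x x' => by simp)

@[simp] theorem shiftRight_of (m : M) (i : ℕ) (x : BimodulePower A M i) :
    shiftRight A m (of _ i x) = of _ (i + 1) (BimodulePower.tmul i x m) :=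
  DirectSum.toAddMonoid_of _ _ _

variable (A M) in
/-- The right action of the tensor ring on the direct sum of the tensor powers, in which `A` acts
as it does on each power and `M` acts by the shifts. -/
noncomputable def gradedAction : TensorRing A M →+* (AddMonoid.End (Graded A M))ᵐᵒᵖ :=
  lift ((Module.toAddMonoidEnd Aᵐᵒᵖ (Graded A M)).op.comp (RingEquiv.opOp A).toRingHom)
    (AddMonoidHom.mk' (fun m => MulOpposite.op (shiftRight A m)) fun m m' => by
      refine congrArg MulOpposite.op (DirectSum.addHom_ext fun i x => ?_)
      change shiftRight A (m + m') (of _ i x) =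
        shiftRight A m (of _ i x) + shiftRight A m' (of _ i x)
      simp)
    (fun a m => by
      refine congrArg MulOpposite.op (DirectSum.addHom_ext fun i x => ?_)
      change shiftRight A _ _ =
        shiftRight A _ (MulOpposite.op a • of (BimodulePower A M) i x)
      simp [op_smul_of, BimodulePower.tmul_smul])
    (fun a m => by
      refine congrArg MulOpposite.op (DirectSum.addHom_ext fun i x => ?_)
      change shiftRight A _ _ = MulOpposite.op a • shiftRight A m (of _ i x)
      simp [op_smul_of])

noncomputable instance : Module (TensorRing A M)ᵐᵒᵖ (Graded A M) :=
  Module.compHom _ ((RingEquiv.opOp (AddMonoid.End (Graded A M))).symm.toRingHom.comp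
    (gradedAction A M).op)

@[simp] theorem op_ofRing_smul (a : A) (s : Graded A M) :
    MulOpposite.op (ofRing A M a) • s = MulOpposite.op a • s :=
  DFunLike.congr_fun (congrArg (MulOpposite.unop (α := AddMonoid.End (Graded A M)))
    (lift_ofRing _ _ _ _ a)) s

@[simp] theorem op_ofBimodule_smul (m : M) (s : Graded A M) :
    MulOpposite.op (ofBimodule A M m) • s = shiftRight A m s :=
  DFunLike.congr_fun (congrArg (MulOpposite.unop (α := AddMonoid.End (Graded A M)))
    (lift_ofBimodule _ _ _ _ m)) s

theorem ofGraded_op_smul (t : TensorRing A M) (s : Graded A M) :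
    ofGraded A M (MulOpposite.op t • s) = ofGraded A M s * t := by
  induction t using induction_on generalizing s with
  | ofRing a => rw [op_ofRing_smul, map_smul, op_smul_eq_mul_ofRing, MulOpposite.unop_op]
  | ofBimodule m =>
    rw [op_ofBimodule_smul]
    induction s using DirectSum.induction_on with
    | zero => simp
    | of i x => simp
    | add s t hs ht => rw [map_add, map_add, map_add, hs, ht, add_mul]
  | add t t' h h' => rw [MulOpposite.op_add, add_smul, map_add, h, h', mul_add]
  | mul t t' h h' => rw [MulOpposite.op_mul, mul_smul, h', h, mul_assoc]

variable (A M) in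
/-- The section of `ofGraded` which lets an element of the tensor ring act on the unit of the
direct sum of the tensor powers. -/
noncomputable def toGraded : TensorRing A M →ₗ[Aᵐᵒᵖ] Graded A M where
  toFun t := MulOpposite.op t • of (BimodulePower A M) 0 (1 : A)
  map_add' t t' := by rw [MulOpposite.op_add, add_smul]
  map_smul' a t := by
    rw [op_smul_eq_mul_ofRing, MulOpposite.op_mul, mul_smul, op_ofRing_smul,
      MulOpposite.op_unop, RingHom.id_apply]

theorem ofGraded_toGraded (t : TensorRing A M) : ofGraded A M (toGraded A M t) = t :=
  calc ofGraded A M (toGraded A M t)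
    _ = ofGraded A M (of (BimodulePower A M) 0 (1 : A)) * t := ofGraded_op_smul t _
    _ = ofRing A M 1 * t := congrArg (· * t) (ofGraded_of _ _)
    _ = t := by rw [map_one, one_mul]

instance projective [Module.Projective Aᵐᵒᵖ M] : Module.Projective Aᵐᵒᵖ (TensorRing A M) :=
  .of_split (toGraded A M) (ofGraded A M) (LinearMap.ext ofGraded_toGraded)

theorem finite [Module.Finite Aᵐᵒᵖ M] {n : ℕ} (hn : Subsingleton (BimodulePower A M n)) :
    Module.Finite Aᵐᵒᵖ (TensorRing A M) := by
  let N : Submodule Aᵐᵒᵖ (TensorRing A M) := ⨆ i ∈ Finset.range n, (ofPower A M i).range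
  have ofGraded_mem (s : Graded A M) : ofGraded A M s ∈ N := by
    induction s using DirectSum.induction_on with
    | zero => rw [map_zero]; exact N.zero_mem
    | add s s' hs hs' => rw [map_add]; exact N.add_mem hs hs'
    | of i x =>
      rw [ofGraded_of]
      by_cases hi : i ∈ Finset.range n
      · exact Submodule.mem_iSup_of_mem i (Submodule.mem_iSup_of_mem hi ⟨x, rfl⟩)
      · have := BimodulePower.subsingleton_of_le hn (not_lt.1 (mt Finset.mem_range.2 hi))
        rw [Subsingleton.elim x 0, map_zero]
        exact N.zero_mem
  have hN : N = ⊤ := eq_top_iff.2 fun t _ => ofGraded_toGraded t ▸ ofGraded_mem _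
  exact ⟨hN ▸ Submodule.fg_biSup _ _ fun i _ => Module.Finite.iff_fg.1 inferInstance⟩

end Grading

end TensorRing

namespace TensorRing

variable (A M : Type u) [Ring A] [AddCommGroup M] [Module A M] [Module Aᵐᵒᵖ M]

section FoxDerivative

open TrivSqZeroExt

/-- The right module `M ⊗_A T` over the tensor ring `T`, in which the Fox derivative takes its
values. -/
abbrev Differentials : Type u := BalancedTensor A M (TensorRing A M)

noncomputable instance : Module (TensorRing A M)ᵐᵒᵖ (Differentials A M) :=
  Module.compHom _ (BalancedTensor.actionRight A M (TensorRing A M) (TensorRing A M)ᵐᵒᵖ)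

variable {A M}

theorem op_smul_tmul (s : (TensorRing A M)ᵐᵒᵖ) (m : M) (t : TensorRing A M) :
    s • BalancedTensor.tmul A m t = BalancedTensor.tmul A m (s • t) := rfl

variable (A M) in
/-- The multiplication map `M ⊗_A T → T`. -/
noncomputable def mulDifferential : Differentials A M →ₗ[(TensorRing A M)ᵐᵒᵖ] TensorRing A M :=
  BalancedTensor.liftLinear op_smul_tmul
    (AddMonoidHom.mk' (fun m =>
      LinearMap.mulLeft (TensorRing A M)ᵐᵒᵖ (ofBimodule A M m)) fun m m' => by
        ext
        simp) fun m a t => by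
      simp [ofBimodule_op_smul, smul_eq_ofRing_mul]

@[simp] theorem mulDifferential_tmul (m : M) (t : TensorRing A M) :
    mulDifferential A M (BalancedTensor.tmul A m t) = ofBimodule A M m * t := rfl

theorem toRing_mulDifferential (ξ : Differentials A M) :
    toRing A M (mulDifferential A M ξ) = 0 := by
  induction ξ using BalancedTensor.induction_on with
  | zero => simp
  | tmul m t => simp
  | add ξ ξ' h h' => rw [map_add, map_add, h, h', add_zero]

variable [SMulCommClass A Aᵐᵒᵖ M]

/-- On the left, the tensor ring acts on `M ⊗_A T` through its projection onto `A`. -/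
noncomputable instance : Module (TensorRing A M) (Differentials A M) :=
  Module.compHom _ (toRing A M)

theorem smul_differential (t : TensorRing A M) (ξ : Differentials A M) :
    t • ξ = toRing A M t • ξ := rfl

instance : SMulCommClass (TensorRing A M) (TensorRing A M)ᵐᵒᵖ (Differentials A M) where
  smul_comm t s ξ := by
    induction ξ using BalancedTensor.induction_on with
    | zero => simp only [smul_zero]
    | tmul m t' => rfl
    | add ξ ξ' h h' => simp only [smul_add, h, h']

variable (A M) in
/-- The ring homomorphism `t ↦ (t, ∂ t)` to the square-zero extension of the tensor ring by
`M ⊗_A T`. -/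
noncomputable def foxLift : TensorRing A M →+* TrivSqZeroExt (TensorRing A M) (Differentials A M) :=
  lift ((inlHom _ _).comp (ofRing A M))
    (AddMonoidHom.mk' (fun m => inl (ofBimodule A M m) + inr (BalancedTensor.tmul A m 1))
      fun m m' => by
        rw [map_add, BalancedTensor.add_tmul, inl_add, inr_add]
        abel)
    (fun a m => by
      ext <;> simp [ofBimodule_smul, smul_differential])
    (fun a m => by
      ext <;> simp [ofBimodule_op_smul, op_smul_tmul, BalancedTensor.tmul_smul, smul_eq_ofRing_mul])

theorem fst_foxLift (t : TensorRing A M) : (foxLift A M t).fst = t := by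
  induction t using induction_on with
  | ofRing a => simp [foxLift]
  | ofBimodule m => simp [foxLift]
  | add t t' h h' => rw [map_add, fst_add, h, h']
  | mul t t' h h' => rw [map_mul, fst_mul, h, h']

/-- The Fox derivative `∂ : T → M ⊗_A T`, determined by `∂ a = 0`, `∂ m = m ⊗ 1` and
`∂ (t t') = ε(t) ∂ t' + (∂ t) t'`, where `ε` is the projection of `T` onto `A`. -/
noncomputable def foxDerivative (t : TensorRing A M) : Differentials A M := (foxLift A M t).snd

@[simp] theorem foxDerivative_ofRing (a : A) : foxDerivative (ofRing A M a) = 0 := by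
  simp [foxDerivative, foxLift]

@[simp] theorem foxDerivative_ofBimodule (m : M) :
    foxDerivative (ofBimodule A M m) = BalancedTensor.tmul A m 1 := by
  simp [foxDerivative, foxLift]

theorem foxDerivative_add (t t' : TensorRing A M) :
    foxDerivative (t + t') = foxDerivative t + foxDerivative t' := by
  simp [foxDerivative]

theorem foxDerivative_mul (t t' : TensorRing A M) :
    foxDerivative (t * t') =
      toRing A M t • foxDerivative t' + MulOpposite.op t' • foxDerivative t := by
  rw [foxDerivative, map_mul, snd_mul, fst_foxLift, fst_foxLift, smul_differential]
  rfl

theorem mulDifferential_smul (a : A) (ξ : Differentials A M) :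
    mulDifferential A M (a • ξ) = ofRing A M a * mulDifferential A M ξ := by
  induction ξ using BalancedTensor.induction_on with
  | zero => simp
  | tmul m t => simp [ofBimodule_smul, mul_assoc]
  | add ξ ξ' h h' => rw [smul_add, map_add, map_add, h, h', mul_add]

/-- The fundamental formula of the Fox calculus. -/
theorem mulDifferential_foxDerivative_add_ofRing_toRing (t : TensorRing A M) :
    mulDifferential A M (foxDerivative t) + ofRing A M (toRing A M t) = t := by
  induction t using induction_on with
  | ofRing a => simp
  | ofBimodule m => simp
  | add t t' h h' =>
    conv_rhs => rw [← h, ← h']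
    rw [foxDerivative_add, map_add, map_add, map_add]
    abel
  | mul t t' h h' =>
    calc mulDifferential A M (foxDerivative (t * t')) + ofRing A M (toRing A M (t * t'))
      _ = mulDifferential A M (foxDerivative t) * t' + ofRing A M (toRing A M t) *
          (mulDifferential A M (foxDerivative t') + ofRing A M (toRing A M t')) := by
        rw [foxDerivative_mul, map_add, mulDifferential_smul, map_smul, map_mul, map_mul, mul_add,
          op_smul_eq_mul]
        abel
      _ = t * t' := by rw [h', ← add_mul, h]

end FoxDerivative

section AugmentationIdeal

variable {A M} [SMulCommClass A Aᵐᵒᵖ M]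

theorem mulDifferential_foxDerivative {t : TensorRing A M} (ht : toRing A M t = 0) :
    mulDifferential A M (foxDerivative t) = t := by
  simpa [ht] using mulDifferential_foxDerivative_add_ofRing_toRing t

theorem projective_ker_toRing_op [Module.Projective Aᵐᵒᵖ M] :
    Module.Projective (TensorRing A M)ᵐᵒᵖ (RingHom.ker (toRing A M).op) := by
  have toRing_eq_zero (x : RingHom.ker (toRing A M).op) : toRing A M x.1.unop = 0 :=
    MulOpposite.op_injective x.2
  have : Module.Projective (TensorRing A M)ᵐᵒᵖ (TensorRing A M) :=
    .of_equiv (MulOpposite.opLinearEquiv (TensorRing A M)ᵐᵒᵖ).symm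
  have : Module.Projective (TensorRing A M)ᵐᵒᵖ (Differentials A M) :=
    BalancedTensor.projective op_smul_tmul
  let D : RingHom.ker (toRing A M).op →ₗ[(TensorRing A M)ᵐᵒᵖ] Differentials A M :=
    { toFun x := foxDerivative x.1.unop
      map_add' x x' := foxDerivative_add _ _
      map_smul' t x := by
        refine (foxDerivative_mul _ _).trans ?_
        rw [toRing_eq_zero, zero_smul, zero_add]
        rfl }
  let μ : Differentials A M →ₗ[(TensorRing A M)ᵐᵒᵖ] RingHom.ker (toRing A M).op :=
    { toFun ξ := ⟨.op (mulDifferential A M ξ), congrArg _ (toRing_mulDifferential ξ)⟩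
      map_add' ξ ξ' := Subtype.ext (congrArg MulOpposite.op (map_add _ ξ ξ'))
      map_smul' t ξ := Subtype.ext (congrArg MulOpposite.op (map_smul _ t ξ)) }
  exact .of_split D μ (LinearMap.ext fun x => Subtype.ext
    (congrArg MulOpposite.op (mulDifferential_foxDerivative (toRing_eq_zero x))))

variable (A M) in
/-- The right ideal `M^{⊗i} T` of the tensor ring `T`, as a left ideal of the opposite ring. -/
noncomputable def powerIdeal (i : ℕ) : Ideal (TensorRing A M)ᵐᵒᵖ :=
  Ideal.span (MulOpposite.op '' Set.range (ofPower A M i))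

theorem op_ofPower_mul_mem_powerIdeal {i : ℕ} (x : BimodulePower A M i) {t : TensorRing A M}
    (ht : toRing A M t = 0) : MulOpposite.op (ofPower A M i x * t) ∈ powerIdeal A M (i + 1) := by
  rw [← mulDifferential_foxDerivative ht]
  induction foxDerivative t using BalancedTensor.induction_on with
  | zero => simp
  | tmul m t' =>
    rw [mulDifferential_tmul, ← mul_assoc, ← ofPower_tmul, MulOpposite.op_mul]
    exact Ideal.mul_mem_left _ _ (Ideal.subset_span ⟨_, ⟨_, rfl⟩, rfl⟩)
  | add ξ ξ' h h' =>
    rw [map_add, mul_add, MulOpposite.op_add]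
    exact add_mem h h'

theorem ker_toRing_op_pow_le_powerIdeal (n : ℕ) :
    RingHom.ker (toRing A M).op ^ n ≤ powerIdeal A M n := by
  induction n with
  | zero =>
    have one_mem : 1 ∈ powerIdeal A M 0 :=
      Ideal.subset_span ⟨1, ⟨(1 : A), map_one (ofRing A M)⟩, rfl⟩
    rw [(Ideal.eq_top_iff_one _).2 one_mem]
    exact le_top
  | succ n ih =>
    rw [Ideal.IsTwoSided.pow_succ, Ideal.mul_le]
    intro r hr s hs
    replace hs : s ∈ Submodule.span _ _ := ih hs
    clear ih
    induction hs using Submodule.span_induction generalizing r with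
    | mem s hs =>
      obtain ⟨_, ⟨x, rfl⟩, rfl⟩ := hs
      exact op_ofPower_mul_mem_powerIdeal x (MulOpposite.op_injective hr)
    | zero => simp
    | add s s' _ _ h h' =>
      rw [mul_add]
      exact add_mem (h r hr) (h' r hr)
    | smul c s _ h =>
      rw [smul_eq_mul, ← mul_assoc]
      exact h _ (Ideal.mul_mem_right _ _ hr)

theorem ker_toRing_op_pow_eq_bot {n : ℕ} (hnil : Subsingleton (BimodulePower A M n)) :
    RingHom.ker (toRing A M).op ^ n = ⊥ := by
  refine eq_bot_iff.2 ((ker_toRing_op_pow_le_powerIdeal n).trans (Ideal.span_le.2 ?_))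
  rintro _ ⟨_, ⟨x, rfl⟩, rfl⟩
  rw [Subsingleton.elim x 0, map_zero]
  exact zero_mem _

end AugmentationIdeal

end TensorRing

section NoetherAlgebra

variable (R : Type*) {A M : Type*} [CommRing R] [Ring A] [Algebra R A] [Module.Finite R A]

variable (A) in
theorem isNoetherianRing_op [IsNoetherianRing R] : IsNoetherianRing Aᵐᵒᵖ :=
  have : Module.Finite R Aᵐᵒᵖ := .equiv (MulOpposite.opLinearEquiv R)
  .of_finite R Aᵐᵒᵖ

variable {R}

theorem finite_op_of_finite [AddCommGroup M] [Module A M] [Module Aᵐᵒᵖ M] [Module.Finite A M]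
    (hcentral : ∀ (r : R) (x : M),
      algebraMap R A r • x = MulOpposite.op (algebraMap R A r) • x) :
    Module.Finite Aᵐᵒᵖ M := by
  let : Module R M := Module.compHom M (algebraMap R A)
  have smul_eq (r : R) (x : M) : r • x = algebraMap R A r • x := rfl
  have : IsScalarTower R A M := ⟨fun r a x => by rw [smul_eq, Algebra.smul_def, mul_smul]⟩
  have : IsScalarTower R Aᵐᵒᵖ M := ⟨fun r a x => by
    rw [smul_eq, hcentral, ← mul_smul, Algebra.smul_def]
    rfl⟩
  have : Module.Finite R M := .trans A M
  exact .of_restrictScalars_finite R Aᵐᵒᵖ M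

end NoetherAlgebra

namespace TensorRing

variable {A M : Type u} [Ring A] [AddCommGroup M] [Module A M] [Module Aᵐᵒᵖ M]

theorem toRing_op_comp_ofRing_op :
    (toRing A M).op.comp (ofRing A M).op = RingHom.id Aᵐᵒᵖ :=
  RingHom.ext fun a => MulOpposite.unop_injective (toRing_ofRing a.unop)

variable (A M) in
/-- The right `A`-module underlying the tensor ring, as the restriction of scalars of the regular
module. -/
noncomputable def opRestrictScalarsEquiv : TensorRing A M ≃ₗ[Aᵐᵒᵖ]
    (ModuleCat.restrictScalars.{u} (ofRing A M).op).obj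
      (ModuleCat.of (TensorRing A M)ᵐᵒᵖ (TensorRing A M)ᵐᵒᵖ) :=
  { MulOpposite.opAddEquiv (α := TensorRing A M) with map_smul' := fun _ _ => rfl }

variable [SMulCommClass A Aᵐᵒᵖ M]

theorem isFiniteAlong_ofRing_op [Module.Finite Aᵐᵒᵖ M] {n : ℕ}
    (hnil : Subsingleton (BimodulePower A M n)) : IsFiniteAlong (ofRing A M).op :=
  have := TensorRing.finite hnil
  .equiv (opRestrictScalarsEquiv A M)

theorem projective_restrictScalars_ofRing_op [Module.Projective Aᵐᵒᵖ M] :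
    Module.Projective Aᵐᵒᵖ ((ModuleCat.restrictScalars.{u} (ofRing A M).op).obj
      (ModuleCat.of (TensorRing A M)ᵐᵒᵖ (TensorRing A M)ᵐᵒᵖ)) :=
  .of_equiv (opRestrictScalarsEquiv A M)

end TensorRing

theorem mainTheorem7_general {Γ M : Type u} [Ring Γ] [IsNoetherianRing Γᵐᵒᵖ]
    [AddCommGroup M] [Module Γ M] [Module Γᵐᵒᵖ M] [SMulCommClass Γ Γᵐᵒᵖ M]
    [Module.Finite Γᵐᵒᵖ M]
    (n : ℕ) (hn : 1 ≤ n) (hnil : Subsingleton (BimodulePower Γ M n)) :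
    ∃ _ : IsNoetherianRing (TensorRing Γ M)ᵐᵒᵖ,
      (Module.Projective Γᵐᵒᵖ M →
        ringIT Γ ≤ ringIT (TensorRing Γ M) ∧
          ringIT (TensorRing Γ M) ≤ n * (ringIT Γ + 1) - 1) ∧
      (ringExtDim Γ ≤ ringExtDim (TensorRing Γ M) ∧
        ringExtDim (TensorRing Γ M) ≤ n * (ringExtDim Γ + 1) - 1) ∧
      (ringDerDim Γ ≤ ringDerDim (TensorRing Γ M) ∧
        ringDerDim (TensorRing Γ M) ≤ n * (ringDerDim Γ + 1) - 1) := by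
  have hsplit := TensorRing.toRing_op_comp_ofRing_op (A := Γ) (M := M)
  have hfin := TensorRing.isFiniteAlong_ofRing_op hnil
  have hT : IsNoetherianRing (TensorRing Γ M)ᵐᵒᵖ := hfin.isNoetherianRing
  have hpow := TensorRing.ker_toRing_op_pow_eq_bot hnil
  refine ⟨hT, fun _ => ?_, extensionDimension_of_split_extension hsplit hfin hn hpow, ?_⟩
  · exact igusaTodorovDistance_of_split_extension hsplit hfin hn hpow
      TensorRing.projective_restrictScalars_ofRing_op TensorRing.projective_ker_toRing_op
  · let := HasDerivedCategory.standard (FGModuleCat.{u} Γᵐᵒᵖ)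
    let := HasDerivedCategory.standard (FGModuleCat.{u} (TensorRing Γ M)ᵐᵒᵖ)
    exact rouquierDimension_of_split_extension hsplit hfin hn hpow

theorem mainTheorem7 {R : Type w} [CommRing R] [IsNoetherianRing R]
    {Γ M : Type u} [Ring Γ] [Algebra R Γ] [Module.Finite R Γ]
    [AddCommGroup M] [Module Γ M] [Module Γᵐᵒᵖ M] [SMulCommClass Γ Γᵐᵒᵖ M]
    (hcentral : ∀ (r : R) (x : M),
      algebraMap R Γ r • x = MulOpposite.op (algebraMap R Γ r) • x)
    [Module.Finite Γ M]
    (n : ℕ) (hn : 1 ≤ n) (hnil : Subsingleton (BimodulePower Γ M n)) :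
    ∃ (_ : IsNoetherianRing Γᵐᵒᵖ) (_ : IsNoetherianRing (TensorRing Γ M)ᵐᵒᵖ),
      (Module.Projective Γ M → Module.Projective Γᵐᵒᵖ M →
        (ringIT Γ ≤ ringIT (TensorRing Γ M) ∧
          ringIT (TensorRing Γ M) ≤ n * (ringIT Γ + 1) - 1) ∧
        (ringExtDim Γ ≤ ringExtDim (TensorRing Γ M) ∧
          ringExtDim (TensorRing Γ M) ≤ n * (ringExtDim Γ + 1) - 1)) ∧
      (IsLeftPerfect Γ M →
        ringDerDim Γ ≤ ringDerDim (TensorRing Γ M) ∧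
          ringDerDim (TensorRing Γ M) ≤ n * (ringDerDim Γ + 1) - 1) := by
  have hΓ : IsNoetherianRing Γᵐᵒᵖ := isNoetherianRing_op R Γ
  have : Module.Finite Γᵐᵒᵖ M := finite_op_of_finite hcentral
  obtain ⟨hT, hIT, hdim, hder⟩ := mainTheorem7_general n hn hnil
  exact ⟨hΓ, hT, fun _ hM => ⟨hIT hM, hdim⟩, fun _ => hder⟩
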